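/- Let $n,\alpha\ge 0$, let $x=(x_1,\dots,x_n)$ be variables, and write $\mathbb R[x]_d$ for the polynomials of degree at most $d$, $s(d)=\binom{d+n}{n}$, and $\vec x_d$ for the column vector of the $s(d)$ monomials of degree at most $d$. A linear pencil is a symmetric $\alpha\times\alpha$ matrix $A$ with entries in $\mathbb R[x]_1$; its spectrahedron is $S_A=\{x\in\mathbb R^n : A(x)\succeq 0\}$. A quadratic sos-matrix is a matrix polynomial $S$ with entries of degree at most $2$ that has the form $S=P^*P$ for some (rectangular) real matrix polynomial $P$, where $^*$ denotes the transpose. **(1) Certificate.** Let $A$ be a linear pencil and $f\in\mathbb R[x]_1$. Then $f\ge 0$ on $S_A$ if and only if there exist quadratic sos-matrices $S_1,\dots,S_n$ of size $\alpha\times\alpha$, real symmetric $s(1)\times s(1)$ matrices $U_1,\dots,U_n$, real $s(2)\times s(1)$ matrices $W_1,\dots,W_n$, a real positive semidefinite $\alpha\times\alpha$ matrix $S$ and a real number $c\ge 0$ such that, with $W_0:=0$, $$\vec x_1^*U_i\vec x_1+\vec x_2^*W_{i-1}\vec x_1+\operatorname{tr}(AS_i)=0\qquad(i=1,\dots,n),$$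 $$U_i\succeq W_i^*W_i\qquad(i=1,\dots,n),$$ $$f-c+\vec x_2^*W_n\vec x_1-\operatorname{tr}(AS)=0.$$ **(2) Strong duality.** Let $A$ be a linear pencil and $\ell\in\mathbb R[x]_1$. Let $P^*=\inf\{\ell(x): x\in S_A\}$. Let $D^*$ be the optimal value of the sums of squares dual $(D^{\mathrm{sos}})$: maximize $a\in\mathbb R$ over all tuples $(a,S,(S_i),(U_i),(W_i))$ of matrices as in (1) that satisfy the first two conditions in (1) and $\ell-a+\vec x_2^*W_n\vec x_1-\operatorname{tr}(AS)=0$. Then $P^*=D^*$ in $[-\infty,\infty]$ (with $\inf\emptyset=\infty$ and $\sup\emptyset=-\infty$), and if this common value is finite, it is attained in $(D^{\mathrm{sos}})$. **(3) Polynomial size.** Say that a semidefinite program "maximize $g(y)$ subject to $B(y)\succeq 0$", with $B$ a linear pencil of size $\beta$ and $g$ a linear polynomial in $m$ variables $y$, formulates $(D^{\mathrm{sos}})$ for $(A,\ell)$ if some affine map sends $\{y\in\mathbb R^m : B(y)\succeq0\}$ onto the feasible set of $(D^{\mathrm{sos}})$ and carries the objective $g$ to the objective $a$. There is a polynomial $p$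 with nonnegative integer coefficients such that for all $n,\alpha$: for every real linear pencil $A$ of size $\alpha$ in $n$ variables and every $\ell\in\mathbb R[x]_1$, $(D^{\mathrm{sos}})$ is formulated by a semidefinite program with $m,\beta\le p(n+\alpha)$; and if $A$ and $\ell$ have rational coefficients, then $(D^{\mathrm{sos}})$ is formulated by a semidefinite program with rational coefficients whose bit size is at most $p$ of the bit size of $(A,\ell)$. Here the bit size of $(A,\ell)$ is the total number of bits (sign, numerator and denominator in binary) of the $n+1$ coefficients of $\ell$ and of each entry of $A$, and likewise for $(B,g)$. -/

import Mathlib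

noncomputable section

namespace SosDuality

/-! ### Linear pencils, spectrahedra, sos-matrices -/

/-- A linear polynomial: an element of `K[x₁, …, xₙ]` of degree at most one. -/
def IsLinearPoly {K : Type*} [CommSemiring K] {n : ℕ} (f : MvPolynomial (Fin n) K) : Prop :=
  f.totalDegree ≤ 1

/-- A linear pencil: a symmetric matrix polynomial all of whose entries have degree at most one. -/
def IsLinearPencil {K : Type*} [CommSemiring K] {n α : ℕ}
    (A : Matrix (Fin α) (Fin α) (MvPolynomial (Fin n) K)) : Prop :=
  A.IsSymm ∧ ∀ i j, IsLinearPoly (A i j)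

/-- The spectrahedron `S_A`, the set of all `x ∈ ℝⁿ` such that `A(x)` is positive semidefinite. -/
def spectrahedron {n α : ℕ} (A : Matrix (Fin α) (Fin α) (MvPolynomial (Fin n) ℝ)) :
    Set (Fin n → ℝ) :=
  {x | (A.map (MvPolynomial.eval x)).PosSemidef}

/-- An sos-matrix: a matrix polynomial of the form `P* P`, with `P` a rectangular
matrix polynomial. -/
def IsSosMatrix {n m : ℕ} (S : Matrix (Fin m) (Fin m) (MvPolynomial (Fin n) ℝ)) : Prop :=
  ∃ (s : ℕ) (P : Matrix (Fin s) (Fin m) (MvPolynomial (Fin n) ℝ)), S = P.transpose * P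

/-- A quadratic sos-matrix: an sos-matrix all of whose entries have degree at most two. -/
def IsQuadraticSosMatrix {n m : ℕ} (S : Matrix (Fin m) (Fin m) (MvPolynomial (Fin n) ℝ)) : Prop :=
  IsSosMatrix S ∧ ∀ i j, (S i j).totalDegree ≤ 2

/-! ### Vectors of monomials -/

/-- The monomials of degree at most `d` in `n` variables, given by their exponents. They index
the rows and columns of the matrices that are called `s(d)`-dimensional on paper. -/
abbrev MonomialIndex (n d : ℕ) : Type := {m : Fin n →₀ ℕ // m.degree ≤ d}

instance (n d : ℕ) : Fintype (MonomialIndex n d) :=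
  (Finsupp.finite_of_degree_le d).fintype

/-- The column vector of all monomials of degree at most `d`. -/
def monomialVec (n d : ℕ) : MonomialIndex n d → MvPolynomial (Fin n) ℝ :=
  fun m => MvPolynomial.monomial m.1 1

/-- The polynomial `x_e* W x_d` represented by a real matrix `W`, where `x_e` and `x_d` are the
vectors of monomials of degree at most `e` and at most `d`. -/
def polyOfMatrix {n e d : ℕ} (W : Matrix (MonomialIndex n e) (MonomialIndex n d) ℝ) :
    MvPolynomial (Fin n) ℝ :=
  monomialVec n e ⬝ᵥ (W.map MvPolynomial.C).mulVec (monomialVec n d)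

/-! ### The primal program and its sums of squares dual -/

/-- The optimal value of the primal program: minimize `ℓ(x)` subject to `A(x) ⪰ 0`. -/
def primalValue {n α : ℕ} (A : Matrix (Fin α) (Fin α) (MvPolynomial (Fin n) ℝ))
    (l : MvPolynomial (Fin n) ℝ) : EReal :=
  ⨅ x ∈ spectrahedron A, ((MvPolynomial.eval x l : ℝ) : EReal)

/-- The space of tuples `(a, S, (S₁, …, Sₙ), (U₁, …, Uₙ), (W₀, …, Wₙ))` in which the feasible
points of the sums of squares dual live. -/
abbrev SosDualPoint (n α : ℕ) : Type :=
  ℝ × Matrix (Fin α) (Fin α) ℝ ×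
    (Fin n → Matrix (Fin α) (Fin α) (MvPolynomial (Fin n) ℝ)) ×
    (Fin n → Matrix (MonomialIndex n 1) (MonomialIndex n 1) ℝ) ×
    (Fin (n + 1) → Matrix (MonomialIndex n 2) (MonomialIndex n 1) ℝ)

/-- The constraints of the sums of squares dual. The index `i : Fin n` stands for the number
`i + 1` of `{1, …, n}`: `T i` is `S_{i+1}`, `U i` is `U_{i+1}`, whereas `W` is indexed from `0`,
so that `W i.castSucc` is `W_i` and `W i.succ` is `W_{i+1}`. -/
structure SosDualFeasible {n α : ℕ} (A : Matrix (Fin α) (Fin α) (MvPolynomial (Fin n) ℝ))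
    (l : MvPolynomial (Fin n) ℝ) (a : ℝ) (S : Matrix (Fin α) (Fin α) ℝ)
    (T : Fin n → Matrix (Fin α) (Fin α) (MvPolynomial (Fin n) ℝ))
    (U : Fin n → Matrix (MonomialIndex n 1) (MonomialIndex n 1) ℝ)
    (W : Fin (n + 1) → Matrix (MonomialIndex n 2) (MonomialIndex n 1) ℝ) : Prop where
  posSemidef : S.PosSemidef
  sos : ∀ i, IsQuadraticSosMatrix (T i)
  symm : ∀ i, (U i).IsSymm
  zero : W 0 = 0
  step : ∀ i : Fin n,
    polyOfMatrix (U i) + polyOfMatrix (W i.castSucc) + (A * T i).trace = 0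
  dominates : ∀ i : Fin n, (U i - (W i.succ).transpose * W i.succ).PosSemidef
  final : l - MvPolynomial.C a + polyOfMatrix (W (Fin.last n))
    - (A * S.map MvPolynomial.C).trace = 0

/-- The feasible set of the sums of squares dual. -/
def sosDualFeasibleSet {n α : ℕ} (A : Matrix (Fin α) (Fin α) (MvPolynomial (Fin n) ℝ))
    (l : MvPolynomial (Fin n) ℝ) : Set (SosDualPoint n α) :=
  {q | SosDualFeasible A l q.1 q.2.1 q.2.2.1 q.2.2.2.1 q.2.2.2.2}

/-- The optimal value of the sums of squares dual: maximize `a` over the feasible set. -/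
def sosDualValue {n α : ℕ} (A : Matrix (Fin α) (Fin α) (MvPolynomial (Fin n) ℝ))
    (l : MvPolynomial (Fin n) ℝ) : EReal :=
  ⨆ q ∈ sosDualFeasibleSet A l, ((q.1 : ℝ) : EReal)

/-! ### Sizes of semidefinite programs -/

/-- The semidefinite program "maximize `g(y)` subject to `B(y) ⪰ 0`" is a formulation of the sums
of squares dual of `(A, ℓ)`: the feasible set of the latter is the image of the spectrahedron
of `B` under an affine map that carries the objective `g` to the objective `a`. -/
def IsSDPFormulation {n α m β : ℕ} (A : Matrix (Fin α) (Fin α) (MvPolynomial (Fin n) ℝ))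
    (l : MvPolynomial (Fin n) ℝ) (B : Matrix (Fin β) (Fin β) (MvPolynomial (Fin m) ℝ))
    (g : MvPolynomial (Fin m) ℝ) : Prop :=
  IsLinearPencil B ∧ IsLinearPoly g ∧
    ∃ π : (Fin m → ℝ) →ᵃ[ℝ] SosDualPoint n α,
      π '' spectrahedron B = sosDualFeasibleSet A l ∧
        ∀ y, (π y).1 = MvPolynomial.eval y g

/-- The number of bits of a rational number: sign, numerator and denominator in binary. -/
def ratBits (q : ℚ) : ℕ := 1 + q.num.natAbs.size + q.den.size

/-- The number of bits of a rational linear polynomial, written as the list of its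
`n + 1` coefficients. -/
def linearBits {n : ℕ} (f : MvPolynomial (Fin n) ℚ) : ℕ :=
  ratBits (f.coeff 0) + ∑ i, ratBits (f.coeff (Finsupp.single i 1))

/-- The bit size of the rational semidefinite program given by a linear pencil `A` and
a linear objective `ℓ`. -/
def sdpBits {n α : ℕ} (A : Matrix (Fin α) (Fin α) (MvPolynomial (Fin n) ℚ))
    (l : MvPolynomial (Fin n) ℚ) : ℕ :=
  linearBits l + ∑ i, ∑ j, linearBits (A i j)

/-- A rational polynomial, seen as a real one. -/
def toRealPoly {n : ℕ} (f : MvPolynomial (Fin n) ℚ) : MvPolynomial (Fin n) ℝ :=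
  MvPolynomial.map (algebraMap ℚ ℝ) f

end SosDuality

end

/-! Soundness: let x lie in `S_A` and let v be the vector of monomials of degree at most one at x.
If `Wᵢ₋₁ v = 0`, then |Wᵢ v|² ≤ v* Uᵢ v = -tr(A Sᵢ)(x) ≤ 0, so `Wᵢ v = 0`. By induction the last W
contributes nothing at x, and the final identity bounds the linear polynomial from below
(`SosDualFeasible.le_eval`).

Completeness: a subspace V of linear polynomials vanishing on `S_A` is grown, so that after k steps
every W with rows in V ends a chain of length k. A polynomial h may be adjoined when h² + tr(A T),
for some quadratic sos-matrix T, is a sum of products of quadratic polynomials with elements of V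
(`reachable_succ`). Each proper enlargement raises the dimension, so after n steps either 1 lies in
V, or V admits no new h, or dim V ≥ n (`exists_reachable_subspace`).

If 1 lies in V, then f = f · 1 is itself represented by a W with rows in V. Otherwise f is to be
written as c + tr(A S) + v with v in V. If dim V ≥ n, the zero set of V is a single point and the
certificate is explicit (`mem_certificateCone_of_finrank`). If V admits no new h, two sos identities
(`pairVec_mem_of_pairVec_self_mem`, `eq_zero_and_pairVec_self_mem`) show that the cone of all c +
tr(A S) + v is closed and omits -1. A functional separating f from it can then be perturbed into a
positive multiple of evaluation at a point of `S_A` on which V vanishes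
(`mem_certificateCone_of_nonneg`).

Strong duality is the certificate for ℓ - r. For the size bound, quadratic sos-matrices are replaced
by positive semidefinite Gram matrices, U ⪰ W*W by a Schur complement, and each equation by two
inequalities. The resulting pencil has the same form over ℚ and over ℝ. -/

noncomputable section
namespace SosDuality
open MvPolynomial Matrix

/-! ### Polynomials given by coefficient vectors -/

/-- The polynomial of degree at most `d` with given coefficients, as a linear map. -/
def polyOfVec (n d : ℕ) : (MonomialIndex n d → ℝ) →ₗ[ℝ] MvPolynomial (Fin n) ℝ :=
  ∑ m : MonomialIndex n d, (MvPolynomial.monomial m.1).comp (LinearMap.proj m)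

/-- The vector of the coefficients of degree at most `d` of a polynomial, as a linear map. -/
def coeffVec (n d : ℕ) : MvPolynomial (Fin n) ℝ →ₗ[ℝ] (MonomialIndex n d → ℝ) :=
  LinearMap.pi fun m => MvPolynomial.lcoeff ℝ m.1

@[simp] lemma coeffVec_apply {n d : ℕ} (f : MvPolynomial (Fin n) ℝ) (m : MonomialIndex n d) :
    coeffVec n d f m = f.coeff m.1 := rfl

lemma polyOfVec_apply {n d : ℕ} (g : MonomialIndex n d → ℝ) :
    polyOfVec n d g = ∑ m : MonomialIndex n d, MvPolynomial.monomial m.1 (g m) := by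
  simp [polyOfVec]

lemma coeff_polyOfVec {n d : ℕ} (g : MonomialIndex n d → ℝ) (m : MonomialIndex n d) :
    (polyOfVec n d g).coeff m.1 = g m := by
  classical
  simp [polyOfVec_apply, coeff_sum, coeff_monomial, Subtype.coe_inj]

lemma totalDegree_polyOfVec_le {n d : ℕ} (g : MonomialIndex n d → ℝ) :
    (polyOfVec n d g).totalDegree ≤ d := by
  rw [polyOfVec_apply]
  refine totalDegree_finsetSum_le fun m _ => (totalDegree_monomial_le _ _).trans ?_
  exact m.2

lemma degree_le_of_coeff_ne_zero {R : Type*} [CommSemiring R] {n d : ℕ}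
    {f : MvPolynomial (Fin n) R} (hf : f.totalDegree ≤ d) {m : Fin n →₀ ℕ} (hm : f.coeff m ≠ 0) :
    m.degree ≤ d :=
  (le_totalDegree (mem_support_iff.2 hm)).trans hf

lemma polyOfVec_coeffVec {n d : ℕ} {f : MvPolynomial (Fin n) ℝ} (hf : f.totalDegree ≤ d) :
    polyOfVec n d (coeffVec n d f) = f := by
  classical
  ext m
  by_cases hm : m.degree ≤ d
  · exact coeff_polyOfVec (coeffVec n d f) ⟨m, hm⟩
  · rw [by_contra fun h => hm (degree_le_of_coeff_ne_zero (totalDegree_polyOfVec_le _) h),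
      by_contra fun h => hm (degree_le_of_coeff_ne_zero hf h)]

lemma polyOfMatrix_eq_sum {n e d : ℕ} (W : Matrix (MonomialIndex n e) (MonomialIndex n d) ℝ) :
    polyOfMatrix W = ∑ p, ∑ q, MvPolynomial.monomial (p.1 + q.1) (W p q) := by
  simp only [polyOfMatrix, dotProduct, mulVec, monomialVec, map_apply, Finset.mul_sum]
  refine Finset.sum_congr rfl fun p _ => Finset.sum_congr rfl fun q _ => ?_
  rw [C_mul_monomial, monomial_mul]
  simp

lemma polyOfMatrix_eq_sum_mul {n e d : ℕ} (W : Matrix (MonomialIndex n e) (MonomialIndex n d) ℝ) :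
    polyOfMatrix W = ∑ p, MvPolynomial.monomial p.1 1 * polyOfVec n d (W p) := by
  simp [polyOfMatrix_eq_sum, polyOfVec_apply, Finset.mul_sum, monomial_mul]

/-- `polyOfMatrix` as a linear map. -/
def polyOfMatrixLin (n e d : ℕ) :
    Matrix (MonomialIndex n e) (MonomialIndex n d) ℝ →ₗ[ℝ] MvPolynomial (Fin n) ℝ where
  toFun := polyOfMatrix
  map_add' W W' := by simp [polyOfMatrix_eq_sum, Finset.sum_add_distrib]
  map_smul' c W := by simp [polyOfMatrix_eq_sum, Finset.smul_sum, smul_monomial]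

@[simp] lemma polyOfMatrixLin_apply {n e d : ℕ}
    (W : Matrix (MonomialIndex n e) (MonomialIndex n d) ℝ) :
    polyOfMatrixLin n e d W = polyOfMatrix W := rfl

@[simp] lemma polyOfMatrix_zero {n e d : ℕ} :
    polyOfMatrix (0 : Matrix (MonomialIndex n e) (MonomialIndex n d) ℝ) = 0 :=
  map_zero (polyOfMatrixLin n e d)

lemma polyOfMatrix_vecMulVec {n e d : ℕ} (q : MonomialIndex n e → ℝ) (g : MonomialIndex n d → ℝ) :
    polyOfMatrix (vecMulVec q g) = polyOfVec n e q * polyOfVec n d g := by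
  simp [polyOfMatrix_eq_sum, polyOfVec_apply, vecMulVec_apply, Finset.sum_mul_sum, monomial_mul]

/-- Append zero rows to a matrix whose rows are indexed by the monomials of degree at most `d`. -/
def extendRows {n d : ℕ} (e : ℕ) {ι : Type*} (W : Matrix (MonomialIndex n d) ι ℝ) :
    Matrix (MonomialIndex n e) ι ℝ :=
  fun r => if h : r.1.degree ≤ d then W ⟨r.1, h⟩ else 0

/-- Products `Mᵀ * M` have rows indexed in degree at most one, but the chain consumes matrices with
rows indexed in degree at most two. -/
lemma polyOfMatrix_extendRows {n d e d' : ℕ} (hde : d ≤ e)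
    (W : Matrix (MonomialIndex n d) (MonomialIndex n d') ℝ) :
    polyOfMatrix (extendRows e W) = polyOfMatrix W := by
  classical
  rw [polyOfMatrix_eq_sum_mul, polyOfMatrix_eq_sum_mul]
  symm
  let i : MonomialIndex n d → MonomialIndex n e := fun r => ⟨r.1, r.2.trans hde⟩
  have hi : Function.Injective i := fun r s h => Subtype.ext (congrArg (fun z => z.1) h)
  refine Finset.sum_of_injOn i hi.injOn (by simp) ?_ ?_
  · intro r _ hr
    have : ¬ r.1.degree ≤ d := fun h => hr ⟨⟨r.1, h⟩, by simp, rfl⟩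
    simp [extendRows, this]
  · intro r _
    have : (i r).1.degree ≤ d := r.2
    simp only [extendRows, dif_pos this]
    rfl

/-- The constant polynomial `1`, as a vector of coefficients. -/
def oneVec (n d : ℕ) : MonomialIndex n d → ℝ := coeffVec n d 1

@[simp] lemma polyOfVec_oneVec (n d : ℕ) : polyOfVec n d (oneVec n d) = 1 :=
  polyOfVec_coeffVec (by simp)

lemma eq_zero_or_eq_single_of_degree_le_one {n : ℕ} {m : Fin n →₀ ℕ} (hm : m.degree ≤ 1) :
    m = 0 ∨ ∃ i, m = Finsupp.single i 1 := by
  by_cases h : m = 0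
  · exact .inl h
  obtain ⟨i, hi⟩ := Finsupp.ne_iff.1 h
  refine .inr ⟨i, ?_⟩
  ext j
  rw [Finsupp.degree_eq_sum] at hm
  have hi' : 1 ≤ m i := Nat.one_le_iff_ne_zero.2 hi
  have h1 := Finset.add_sum_erase Finset.univ m (Finset.mem_univ i)
  by_cases hj : j = i
  · subst hj
    simp
    omega
  · have := Finset.single_le_sum (f := m) (fun _ _ => Nat.zero_le _)
      (Finset.mem_erase.2 ⟨hj, Finset.mem_univ j⟩)
    rw [Finsupp.single_eq_of_ne hj]
    omega

/-- A linear functional on the linear polynomials that maps `1` to `1` is an evaluation. -/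
lemma exists_eval_eq {n : ℕ} (φ : (MonomialIndex n 1 → ℝ) →ₗ[ℝ] ℝ) (hφ : φ (oneVec n 1) = 1) :
    ∃ x : Fin n → ℝ, ∀ g, eval x (polyOfVec n 1 g) = φ g := by
  classical
  refine ⟨fun i => φ (coeffVec n 1 (X i)), fun g => ?_⟩
  have hg : g = ∑ m, g m • (Pi.single m (1 : ℝ)) := by
    ext m; simp [Finset.sum_apply, Pi.single_apply]
  have key : ∀ m : MonomialIndex n 1, eval (fun i => φ (coeffVec n 1 (X i))) (monomial m.1 1)
      = φ (Pi.single m 1) := by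
    intro m
    rcases eq_zero_or_eq_single_of_degree_le_one m.2 with h | ⟨i, h⟩
    · have : oneVec n 1 = Pi.single m 1 := by
        ext m'
        simp [oneVec, coeff_one, Pi.single_apply, Subtype.ext_iff, h, eq_comm]
      rw [h, ← this, hφ]
      simp
    · have : coeffVec n 1 (X i) = Pi.single m 1 := by
        ext m'
        simp [coeff_X, Pi.single_apply, Subtype.ext_iff, h, eq_comm]
      rw [← this, h]
      simp [eval_monomial]
  rw [polyOfVec_apply, map_sum]
  conv_rhs => rw [hg, map_sum]
  refine Finset.sum_congr rfl fun m _ => ?_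
  rw [map_smul, ← key, ← mul_one (g m), ← smul_eq_mul, ← smul_monomial, smul_eval]
  simp

/-- There are at most `(n + 1) ^ d` monomials of degree at most `d` in `n` variables. -/
lemma card_monomialIndex_le (n d : ℕ) : Fintype.card (MonomialIndex n d) ≤ (n + 1) ^ d := by
  classical
  induction d with
  | zero =>
    refine Fintype.card_le_one_iff.2 fun a b => Subtype.ext ?_
    have ha := (Finsupp.degree_eq_zero_iff a.1).1 (Nat.le_zero.1 a.2)
    have hb := (Finsupp.degree_eq_zero_iff b.1).1 (Nat.le_zero.1 b.2)
    rw [ha, hb]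
  | succ d ih =>
    -- Every monomial of degree at most d + 1 is one of degree at most d times a variable or 1;
    -- `none` stands for the factor 1.
    let s : MonomialIndex n d × Option (Fin n) → MonomialIndex n (d + 1) := fun p =>
      ⟨p.1.1 + p.2.elim 0 (fun i => Finsupp.single i 1), by
        rcases p with ⟨⟨m, hm⟩, _ | i⟩
        · simpa using hm.trans (Nat.le_succ d)
        · simpa [map_add, Finsupp.degree_single] using hm⟩
    have hs : Function.Surjective s := by
      rintro ⟨m, hm⟩
      by_cases h : m = 0
      · exact ⟨(⟨0, by simp⟩, none), Subtype.ext (by simp [s, h])⟩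
      obtain ⟨i, hi⟩ := Finsupp.ne_iff.1 h
      have hle : Finsupp.single i 1 ≤ m := by
        rw [Finsupp.single_le_iff]
        exact Nat.one_le_iff_ne_zero.2 hi
      have hd : (m - Finsupp.single i 1).degree ≤ d := by
        have := congrArg Finsupp.degree (tsub_add_cancel_of_le hle)
        rw [map_add, Finsupp.degree_single] at this
        omega
      exact ⟨(⟨_, hd⟩, some i), Subtype.ext (tsub_add_cancel_of_le hle)⟩
    calc _ ≤ Fintype.card (MonomialIndex n d × Option (Fin n)) := Fintype.card_le_of_surjective s hs
      _ = Fintype.card (MonomialIndex n d) * (n + 1) := by simp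
      _ ≤ (n + 1) ^ (d + 1) := by rw [pow_succ]; gcongr

end SosDuality
end

noncomputable section
namespace SosDuality
open MvPolynomial Matrix

/-! ### Sos-matrices and positive semidefinite matrices -/

lemma trace_mul_transpose_mul {R : Type*} [CommRing R] {α : Type*} [Fintype α] {ι : Type*}
    [Fintype ι] (A : Matrix α α R) (P : Matrix ι α R) :
    (A * (Pᵀ * P)).trace = ∑ k, P k ⬝ᵥ A *ᵥ P k := by
  rw [← Matrix.mul_assoc, Matrix.trace_mul_comm, ← Matrix.mul_assoc, Matrix.trace]
  refine Finset.sum_congr rfl fun k _ => ?_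
  rw [diag_apply, Matrix.mul_assoc, Matrix.mul_apply]
  rfl

lemma posSemidef_iff_exists_transpose_mul {α : Type*} [Fintype α] {S : Matrix α α ℝ} :
    S.PosSemidef ↔ ∃ B : Matrix α α ℝ, S = Bᵀ * B := by
  classical
  open scoped MatrixOrder in
  rw [← Matrix.nonneg_iff_posSemidef]
  constructor
  · intro h
    obtain ⟨X, hX⟩ := CStarAlgebra.nonneg_iff_eq_star_mul_self.1 h
    exact ⟨X, by rw [hX, Matrix.star_eq_conjTranspose, conjTranspose_eq_transpose_of_trivial]⟩
  · rintro ⟨B, rfl⟩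
    rw [← conjTranspose_eq_transpose_of_trivial]
    exact (posSemidef_conjTranspose_mul_self B).nonneg

lemma posSemidef_transpose_mul_self {ι α : Type*} [Fintype ι] [Finite α] (B : Matrix ι α ℝ) :
    (Bᵀ * B).PosSemidef := by
  rw [← conjTranspose_eq_transpose_of_trivial]
  exact posSemidef_conjTranspose_mul_self B

variable {n α : ℕ}

lemma isQuadraticSosMatrix_transpose_mul {s : ℕ}
    (P : Matrix (Fin s) (Fin α) (MvPolynomial (Fin n) ℝ))
    (hP : ∀ k i, (P k i).totalDegree ≤ 1) : IsQuadraticSosMatrix (Pᵀ * P) := by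
  refine ⟨⟨s, P, rfl⟩, fun i j => ?_⟩
  rw [Matrix.mul_apply]
  refine totalDegree_finsetSum_le fun k _ => (totalDegree_mul _ _).trans ?_
  have h1 := hP k i
  have h2 := hP k j
  simp only [transpose_apply]
  omega

lemma isQuadraticSosMatrix_zero :
    IsQuadraticSosMatrix (0 : Matrix (Fin α) (Fin α) (MvPolynomial (Fin n) ℝ)) :=
  ⟨⟨0, 0, by simp⟩, by simp⟩

lemma IsQuadraticSosMatrix.smul {T : Matrix (Fin α) (Fin α) (MvPolynomial (Fin n) ℝ)}
    (hT : IsQuadraticSosMatrix T) {c : ℝ} (hc : 0 ≤ c) : IsQuadraticSosMatrix (c • T) := by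
  obtain ⟨⟨s, P, rfl⟩, hd⟩ := hT
  refine ⟨⟨s, Real.sqrt c • P, ?_⟩, fun i j => (totalDegree_smul_le _ _).trans (hd i j)⟩
  rw [transpose_smul, Matrix.smul_mul, Matrix.mul_smul, smul_smul, Real.mul_self_sqrt hc]

/-! ### Reachable matrices -/

/-- The matrices `W` that occur as `Wᵢ` in a chain
`xᵀ Uⱼ x + xᵀ Wⱼ₋₁ x + tr (A Sⱼ) = 0`, `Uⱼ ⪰ Wⱼᵀ Wⱼ`, starting with `W₀ = 0`. -/
def Reachable (A : Matrix (Fin α) (Fin α) (MvPolynomial (Fin n) ℝ)) :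
    ℕ → Matrix (MonomialIndex n 2) (MonomialIndex n 1) ℝ → Prop
  | 0, W => W = 0
  | i + 1, W => ∃ (W' : Matrix (MonomialIndex n 2) (MonomialIndex n 1) ℝ)
      (T : Matrix (Fin α) (Fin α) (MvPolynomial (Fin n) ℝ))
      (U : Matrix (MonomialIndex n 1) (MonomialIndex n 1) ℝ),
      Reachable A i W' ∧ IsQuadraticSosMatrix T ∧ U.IsSymm ∧
      polyOfMatrix U + polyOfMatrix W' + (A * T).trace = 0 ∧ (U - Wᵀ * W).PosSemidef

/-- The recursive predicate suits the induction on dimension; unrolling it gives the indexed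
families of the certificate. -/
lemma Reachable.exists_chain {A : Matrix (Fin α) (Fin α) (MvPolynomial (Fin n) ℝ)} {k : ℕ}
    {W : Matrix (MonomialIndex n 2) (MonomialIndex n 1) ℝ} (h : Reachable A k W) :
    ∃ (T : Fin k → Matrix (Fin α) (Fin α) (MvPolynomial (Fin n) ℝ))
      (U : Fin k → Matrix (MonomialIndex n 1) (MonomialIndex n 1) ℝ)
      (W' : Fin (k + 1) → Matrix (MonomialIndex n 2) (MonomialIndex n 1) ℝ),
      (∀ i, IsQuadraticSosMatrix (T i)) ∧ (∀ i, (U i).IsSymm) ∧ W' 0 = 0 ∧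
      (∀ i : Fin k,
        polyOfMatrix (U i) + polyOfMatrix (W' i.castSucc) + (A * T i).trace = 0) ∧
      (∀ i : Fin k, (U i - (W' i.succ)ᵀ * W' i.succ).PosSemidef) ∧ W' (Fin.last k) = W := by
  induction k generalizing W with
  | zero => exact ⟨Fin.elim0, Fin.elim0, fun _ => 0, (·.elim0), (·.elim0), rfl, (·.elim0),
      (·.elim0), h.symm⟩
  | succ k ih =>
    obtain ⟨W₁, T₁, U₁, hW₁, hT₁, hU₁, he, hd⟩ := h
    obtain ⟨T, U, W', hT, hU, h0, hs, hp, hl⟩ := ih hW₁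
    refine ⟨Fin.snoc (α := fun _ => _) T T₁, Fin.snoc (α := fun _ => _) U U₁,
      Fin.snoc (α := fun _ => _) W' W, ?_, ?_, ?_, ?_, ?_, ?_⟩
    · intro i
      refine Fin.lastCases ?_ (fun i => ?_) i
      · simpa using hT₁
      · simpa using hT i
    · intro i
      refine Fin.lastCases ?_ (fun i => ?_) i
      · simpa using hU₁
      · simpa using hU i
    · have : (0 : Fin (k + 1 + 1)) = Fin.castSucc 0 := rfl
      rw [this, Fin.snoc_castSucc, h0]
    · intro i
      refine Fin.lastCases ?_ (fun i => ?_) i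
      · simpa [hl] using he
      · simpa using hs i
    · intro i
      refine Fin.lastCases ?_ (fun i => ?_) i
      · simpa using hd
      · simp only [Fin.succ_castSucc, Fin.snoc_castSucc]
        exact hp i
    · simp

/-- The polynomials `xᵀ W x` with `W` a matrix all of whose rows lie in `V`. -/
def rowPolys (V : Submodule ℝ (MonomialIndex n 1 → ℝ)) : Submodule ℝ (MvPolynomial (Fin n) ℝ) :=
  (Submodule.pi Set.univ fun _ : MonomialIndex n 2 => V).map (polyOfMatrixLin n 2 1)

lemma mem_rowPolys {V : Submodule ℝ (MonomialIndex n 1 → ℝ)} {f : MvPolynomial (Fin n) ℝ} :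
    f ∈ rowPolys V ↔ ∃ W : Matrix (MonomialIndex n 2) (MonomialIndex n 1) ℝ,
      (∀ p, W p ∈ V) ∧ polyOfMatrix W = f :=
  ⟨fun ⟨W, hW, e⟩ => ⟨W, fun p => hW p trivial, e⟩, fun ⟨W, hW, e⟩ => ⟨W, fun p _ => hW p, e⟩⟩

/-- The product is represented by the rank-one matrix of the two coefficient vectors, all of whose
rows are multiples of g. -/
lemma mul_mem_rowPolys {V : Submodule ℝ (MonomialIndex n 1 → ℝ)} {q : MvPolynomial (Fin n) ℝ}
    (hq : q.totalDegree ≤ 2) {g : MonomialIndex n 1 → ℝ} (hg : g ∈ V) :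
    q * polyOfVec n 1 g ∈ rowPolys V :=
  mem_rowPolys.2 ⟨vecMulVec (coeffVec n 2 q) g, fun p => V.smul_mem (coeffVec n 2 q p) hg, by
    rw [polyOfMatrix_vecMulVec, polyOfVec_coeffVec hq]⟩

lemma polyOfVec_mem_rowPolys {V : Submodule ℝ (MonomialIndex n 1 → ℝ)}
    {g : MonomialIndex n 1 → ℝ} (hg : g ∈ V) : polyOfVec n 1 g ∈ rowPolys V := by
  simpa using mul_mem_rowPolys (q := 1) (by simp) hg

/-- The vectors `h` of coefficients for which `h² + tr (A T)` is, for some quadratic sos-matrix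
`T`, of the form `xᵀ W x` with rows of `W` in `V`. -/
def IsStep (A : Matrix (Fin α) (Fin α) (MvPolynomial (Fin n) ℝ))
    (V : Submodule ℝ (MonomialIndex n 1 → ℝ)) (h : MonomialIndex n 1 → ℝ) : Prop :=
  ∃ T : Matrix (Fin α) (Fin α) (MvPolynomial (Fin n) ℝ), IsQuadraticSosMatrix T ∧
    polyOfVec n 1 h ^ 2 + (A * T).trace ∈ rowPolys V

lemma isStep_zero (A : Matrix (Fin α) (Fin α) (MvPolynomial (Fin n) ℝ))
    (V : Submodule ℝ (MonomialIndex n 1 → ℝ)) : IsStep A V 0 :=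
  ⟨0, isQuadraticSosMatrix_zero, by simp⟩

/-- Split W = M + w h* with the rows of M in V. The parallelogram identity (M + wh*)*(M + wh*) + (M
- wh*)*(M - wh*) = 2 M*M + 2|w|² hh* suggests taking its right-hand side as U: then U - W*W is a
square, and the polynomial of U is an element of `rowPolys V` plus 2|w|² h². -/
lemma reachable_succ {A : Matrix (Fin α) (Fin α) (MvPolynomial (Fin n) ℝ)}
    {V : Submodule ℝ (MonomialIndex n 1 → ℝ)} {k : ℕ}
    (hV : ∀ W : Matrix (MonomialIndex n 2) (MonomialIndex n 1) ℝ, (∀ p, W p ∈ V) → Reachable A k W)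
    {h : MonomialIndex n 1 → ℝ} (hh : IsStep A V h)
    (W : Matrix (MonomialIndex n 2) (MonomialIndex n 1) ℝ)
    (hW : ∀ p, W p ∈ V ⊔ Submodule.span ℝ {h}) : Reachable A (k + 1) W := by
  obtain ⟨T, hT, hJ⟩ := hh
  have : ∀ p, ∃ v ∈ V, ∃ c : ℝ, v + c • h = W p := by
    intro p
    obtain ⟨v, hv, z, hz, e⟩ := Submodule.mem_sup.1 (hW p)
    obtain ⟨c, rfl⟩ := Submodule.mem_span_singleton.1 hz
    exact ⟨v, hv, c, e⟩
  choose Wv hWv w hw using this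
  set M : Matrix (MonomialIndex n 2) (MonomialIndex n 1) ℝ := Matrix.of Wv with hM
  have hWeq : W = M + vecMulVec w h := by
    ext p q
    simp [hM, ← hw, vecMulVec_apply]
  have hsq : (vecMulVec w h)ᵀ * vecMulVec w h = (w ⬝ᵥ w) • vecMulVec h h := by
    rw [transpose_vecMulVec, vecMulVec_mul_vecMulVec]
    simp [vecMulVec_smul]
  -- The rows of M*M are linear combinations of the rows of M.
  have hmem : polyOfMatrix (Mᵀ * M) ∈ rowPolys V := by
    rw [← polyOfMatrix_extendRows (show 1 ≤ 2 by norm_num)]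
    refine mem_rowPolys.2 ⟨_, fun r => ?_, rfl⟩
    rw [extendRows]
    split_ifs with hr
    · have : (Mᵀ * M) ⟨r.1, hr⟩ = ∑ p, M p ⟨r.1, hr⟩ • Wv p := by
        ext q
        simp [Matrix.mul_apply, hM, Finset.sum_apply]
      rw [this]
      exact V.sum_mem fun p _ => V.smul_mem _ (hWv p)
    · exact V.zero_mem
  have hc : 0 ≤ 2 * (w ⬝ᵥ w) :=
    mul_nonneg zero_le_two (Finset.sum_nonneg fun i _ => mul_self_nonneg (w i))
  -- The preceding matrix W' has to represent the negative of 2 x*M*Mx + 2|w|²(h² + tr(A T)), so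
  -- that it cancels U together with the rescaled T.
  obtain ⟨W', hW', e'⟩ := mem_rowPolys.1
    ((rowPolys V).neg_mem ((rowPolys V).add_mem ((rowPolys V).smul_mem 2 hmem)
      ((rowPolys V).smul_mem (2 * (w ⬝ᵥ w)) hJ)))
  refine ⟨W', (2 * (w ⬝ᵥ w)) • T, (2 : ℝ) • (Mᵀ * M) + (2 * (w ⬝ᵥ w)) • vecMulVec h h,
    hV W' hW', hT.smul hc, ?_, ?_, ?_⟩
  · simp [Matrix.IsSymm, transpose_mul, transpose_vecMulVec]
  · rw [e', ← polyOfMatrixLin_apply, map_add, map_smul, map_smul, polyOfMatrixLin_apply,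
      polyOfMatrixLin_apply, polyOfMatrix_vecMulVec, Matrix.mul_smul, trace_smul, ← sq]
    simp only [smul_add]
    abel
  · have : (2 : ℝ) • (Mᵀ * M) + (2 * (w ⬝ᵥ w)) • vecMulVec h h - Wᵀ * W
        = (M - vecMulVec w h)ᵀ * (M - vecMulVec w h) := by
      rw [mul_smul, ← hsq, hWeq, transpose_add, transpose_sub, two_smul, two_smul,
        Matrix.add_mul, Matrix.sub_mul, Matrix.mul_add, Matrix.mul_add, Matrix.mul_sub,
        Matrix.mul_sub]
      abel
    rw [this]
    exact posSemidef_transpose_mul_self _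

end SosDuality
end

noncomputable section
namespace SosDuality
open MvPolynomial Matrix

/-! ### Closed cones -/

/-- By compactness of the unit vectors in D, the map satisfies |T x| ≥ δ|x| on D. Preimages of a
convergent sequence are therefore bounded and have a limit point in D. -/
lemma isClosed_image_of_cone {X Y : Type*} [NormedAddCommGroup X] [NormedSpace ℝ X]
    [FiniteDimensional ℝ X] [NormedAddCommGroup Y] [NormedSpace ℝ Y] (T : X →L[ℝ] Y) {D : Set X}
    (hD : IsClosed D) (hsmul : ∀ c : ℝ, 0 ≤ c → ∀ x ∈ D, c • x ∈ D)
    (hker : ∀ x ∈ D, T x = 0 → x = 0) : IsClosed (T '' D) := by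
  have : ProperSpace X := FiniteDimensional.proper ℝ X
  obtain ⟨δ, hδ, hle⟩ : ∃ δ : ℝ, 0 < δ ∧ ∀ x ∈ D, δ * ‖x‖ ≤ ‖T x‖ := by
    have hK : IsCompact (D ∩ Metric.sphere 0 1) := (isCompact_sphere 0 1).inter_left hD
    have hmem : ∀ x ∈ D, x ≠ 0 → ‖x‖⁻¹ • x ∈ D ∩ Metric.sphere 0 1 := fun x hx h0 =>
      ⟨hsmul _ (by positivity) x hx, by simp [norm_smul, norm_ne_zero_iff.2 h0]⟩
    rcases (D ∩ Metric.sphere (0 : X) 1).eq_empty_or_nonempty with he | hne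
    · refine ⟨1, one_pos, fun x hx => ?_⟩
      have : x = 0 := by
        by_contra h0
        have := hmem x hx h0
        rw [he] at this
        exact this
      simp [this]
    · obtain ⟨z, hz, hmin⟩ := hK.exists_isMinOn hne (T.continuous.norm.continuousOn)
      have hz0 : z ≠ 0 := by
        rintro rfl
        simpa using hz.2
      refine ⟨‖T z‖, norm_pos_iff.2 fun h => hz0 (hker z hz.1 h), fun x hx => ?_⟩
      by_cases h0 : x = 0
      · simp [h0]
      have h1 : ‖T z‖ ≤ ‖T (‖x‖⁻¹ • x)‖ := hmin (hmem x hx h0)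
      rw [map_smul, norm_smul, norm_inv, norm_norm, inv_mul_eq_div] at h1
      exact (le_div_iff₀ (norm_pos_iff.2 h0)).1 h1
  refine IsSeqClosed.isClosed fun y y₀ hy hlim => ?_
  choose x hxD hx using hy
  obtain ⟨R, hR⟩ := hlim.norm.bddAbove_range
  have hb : ∀ k, x k ∈ Metric.closedBall (0 : X) (R / δ) := fun k => by
    rw [mem_closedBall_zero_iff, le_div_iff₀ hδ, mul_comm]
    exact ((hle _ (hxD k)).trans_eq (by rw [hx])).trans (hR ⟨k, rfl⟩)
  obtain ⟨a, -, ψ, hψ, ha⟩ := tendsto_subseq_of_bounded Metric.isBounded_closedBall hb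
  refine ⟨a, hD.mem_of_tendsto ha (Filter.Eventually.of_forall fun k => hxD _), ?_⟩
  refine tendsto_nhds_unique ((T.continuous.tendsto a).comp ha) ?_
  have : (T ∘ x ∘ ψ) = y ∘ ψ := funext fun k => hx _
  rw [this]
  exact hlim.comp hψ.tendsto_atTop

lemma exists_dual_of_notMem_closed_cone {E : Type*} [NormedAddCommGroup E] [NormedSpace ℝ E]
    {C : Set E} (hC : IsClosed C) (h0 : 0 ∈ C) (hadd : ∀ x ∈ C, ∀ y ∈ C, x + y ∈ C)
    (hsmul : ∀ c : ℝ, 0 ≤ c → ∀ x ∈ C, c • x ∈ C) {z : E} (hz : z ∉ C) :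
    ∃ φ : E →ₗ[ℝ] ℝ, (∀ x ∈ C, 0 ≤ φ x) ∧ φ z < 0 := by
  let P : ProperCone ℝ E :=
    { carrier := C
      add_mem' := fun {x y} hx hy => hadd x hx y hy
      zero_mem' := h0
      smul_mem' := fun c x hx => hsmul c.1 c.2 x hx
      isClosed' := hC }
  obtain ⟨φ, h1, h2⟩ := P.hyperplane_separation_point (x₀ := z) hz
  exact ⟨φ.toLinearMap, h1, h2⟩

lemma isClosed_setOf_posSemidef (α : Type*) [Fintype α] :
    IsClosed {S : α → α → ℝ | (Matrix.of S).PosSemidef} := by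
  have : {S : α → α → ℝ | (Matrix.of S).PosSemidef} =
      {S | (fun i j => S j i) = S} ∩ ⋂ x : α → ℝ, {S | 0 ≤ ∑ i, x i * ∑ j, S i j * x j} := by
    ext S
    simp only [Set.mem_ofPred_eq, Set.mem_inter_iff, Set.mem_iInter,
      posSemidef_iff_dotProduct_mulVec]
    rfl
  rw [this]
  refine (isClosed_eq (by fun_prop) (by fun_prop)).inter (isClosed_iInter fun x => ?_)
  exact isClosed_le (by fun_prop) (by fun_prop)

lemma exists_add_of_submodule {α : ℕ} (K : Submodule ℝ (Fin α → ℝ)) (u : Fin α → ℝ) :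
    ∃ k ∈ K, ∃ p, (∀ k' ∈ K, p ⬝ᵥ k' = 0) ∧ u = k + p := by
  let e := WithLp.linearEquiv 2 ℝ (Fin α → ℝ)
  obtain ⟨y, hy, z, hz, h⟩ := (K.comap e.toLinearMap).exists_add_mem_mem_orthogonal (e.symm u)
  refine ⟨e y, hy, e z, fun k' hk' => ?_, ?_⟩
  · have := (Submodule.mem_orthogonal _ _).1 hz (e.symm k') (by simpa using hk')
    simpa [PiLp.inner_apply, dotProduct, e] using this
  · rw [← map_add, ← h, LinearEquiv.apply_symm_apply]

variable {n α : ℕ}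

/-! ### The values of a pencil as a bilinear form -/

/-- The coefficients of the linear polynomial `uᵀ A w`. -/
def pairVec (A : Matrix (Fin α) (Fin α) (MvPolynomial (Fin n) ℝ)) (u w : Fin α → ℝ) :
    MonomialIndex n 1 → ℝ :=
  ∑ i, ∑ j, (u i * w j) • coeffVec n 1 (A i j)

/-- The coefficients of the linear polynomial `tr (A S)`, as a linear map of `S`. -/
def traceVec (A : Matrix (Fin α) (Fin α) (MvPolynomial (Fin n) ℝ)) :
    (Fin α → Fin α → ℝ) →ₗ[ℝ] (MonomialIndex n 1 → ℝ) where
  toFun S := ∑ i, ∑ j, S j i • coeffVec n 1 (A i j)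
  map_add' S S' := by simp [add_smul, Finset.sum_add_distrib]
  map_smul' c S := by simp [Finset.smul_sum, mul_smul]

lemma traceVec_apply (A : Matrix (Fin α) (Fin α) (MvPolynomial (Fin n) ℝ))
    (S : Fin α → Fin α → ℝ) : traceVec A S = ∑ i, ∑ j, S j i • coeffVec n 1 (A i j) := rfl

section pencil

variable {A : Matrix (Fin α) (Fin α) (MvPolynomial (Fin n) ℝ)}

lemma pairVec_add_left (u u' w : Fin α → ℝ) :
    pairVec A (u + u') w = pairVec A u w + pairVec A u' w := by
  simp [pairVec, add_mul, add_smul, Finset.sum_add_distrib]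

lemma pairVec_smul_left (c : ℝ) (u w : Fin α → ℝ) :
    pairVec A (c • u) w = c • pairVec A u w := by
  simp [pairVec, mul_assoc, mul_smul, Finset.smul_sum]

lemma pairVec_comm (hA : IsLinearPencil A) (u w : Fin α → ℝ) : pairVec A u w = pairVec A w u := by
  rw [pairVec, pairVec, Finset.sum_comm]
  refine Finset.sum_congr rfl fun i _ => Finset.sum_congr rfl fun j _ => ?_
  rw [hA.1.apply i j, mul_comm]

lemma polyOfVec_pairVec (hA : IsLinearPencil A) (u w : Fin α → ℝ) :
    polyOfVec n 1 (pairVec A u w) = (C ∘ u) ⬝ᵥ A *ᵥ (C ∘ w) := by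
  simp only [pairVec, map_sum, map_smul, polyOfVec_coeffVec (hA.2 _ _), dotProduct, mulVec,
    Finset.mul_sum]
  refine Finset.sum_congr rfl fun i _ => Finset.sum_congr rfl fun j _ => ?_
  simp only [Function.comp, smul_eq_C_mul, C_mul]
  ring

lemma polyOfVec_traceVec (hA : IsLinearPencil A) (S : Matrix (Fin α) (Fin α) ℝ) :
    polyOfVec n 1 (traceVec A S) = (A * S.map C).trace := by
  rw [traceVec_apply A S]
  simp only [map_sum, map_smul,
    polyOfVec_coeffVec (hA.2 _ _), Matrix.trace, diag_apply, Matrix.mul_apply, map_apply]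
  refine Finset.sum_congr rfl fun i _ => Finset.sum_congr rfl fun j _ => ?_
  rw [smul_eq_C_mul, mul_comm]

lemma traceVec_transpose_mul (B : Matrix (Fin α) (Fin α) ℝ) :
    traceVec A (Bᵀ * B) = ∑ k, pairVec A (B k) (B k) := by
  have h : ∀ i j, (Bᵀ * B) j i • coeffVec n 1 (A i j)
      = ∑ k, (B k i * B k j) • coeffVec n 1 (A i j) := fun i j => by
    rw [Matrix.mul_apply, Finset.sum_smul]
    simp only [transpose_apply, mul_comm]
  calc traceVec A (Bᵀ * B) = ∑ i, ∑ j, ∑ k, (B k i * B k j) • coeffVec n 1 (A i j) :=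
        (traceVec_apply A _).trans <| Finset.sum_congr rfl fun i _ => Finset.sum_congr rfl fun j _ => h i j
    _ = ∑ i, ∑ k, ∑ j, (B k i * B k j) • coeffVec n 1 (A i j) :=
        Finset.sum_congr rfl fun i _ => Finset.sum_comm
    _ = _ := Finset.sum_comm

lemma eval_pairVec (hA : IsLinearPencil A) (x : Fin n → ℝ) (u w : Fin α → ℝ) :
    eval x (polyOfVec n 1 (pairVec A u w)) = u ⬝ᵥ A.map (eval x) *ᵥ w := by
  rw [polyOfVec_pairVec hA]
  simp [dotProduct, mulVec]

lemma mem_spectrahedron_iff (hA : IsLinearPencil A) {x : Fin n → ℝ} :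
    x ∈ spectrahedron A ↔ ∀ u, 0 ≤ eval x (polyOfVec n 1 (pairVec A u u)) := by
  simp only [eval_pairVec hA]
  refine posSemidef_iff_dotProduct_mulVec.trans ⟨fun h u => h.2 u, fun h => ⟨?_, fun u => h u⟩⟩
  refine Matrix.IsHermitian.ext fun i j => ?_
  simp [hA.1.apply i j]

variable {V : Submodule ℝ (MonomialIndex n 1 → ℝ)}

/-- This is the analogue modulo V of the fact that an isotropic vector of a positive semidefinite
form lies in its kernel. -/
lemma pairVec_mem_of_pairVec_self_mem (hA : IsLinearPencil A) (hV : ∀ h, IsStep A V h → h ∈ V)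
    {u : Fin α → ℝ} (hu : pairVec A u u ∈ V) (w : Fin α → ℝ) : pairVec A u w ∈ V := by
  set l := polyOfVec n 1 (pairVec A u w) with hl
  set m := polyOfVec n 1 (pairVec A w w) with hm
  have hld : l.totalDegree ≤ 1 := totalDegree_polyOfVec_le _
  have hmd : m.totalDegree ≤ 1 := totalDegree_polyOfVec_le _
  -- For P = p u + l w the form P*AP equals p² u*Au + l²(2p + m). This p makes 2p + m = -1, so that
  -- l² + P*AP = p² u*Au.
  set p : MvPolynomial (Fin n) ℝ := C (-1 / 2) * (1 + m) with hp
  have hpd : p.totalDegree ≤ 1 := by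
    refine (totalDegree_mul _ _).trans ?_
    rw [totalDegree_C, zero_add]
    exact (totalDegree_add _ _).trans (by simpa using hmd)
  have h2p : 2 * p = -(1 + m) := by
    have : (2 : MvPolynomial (Fin n) ℝ) = C 2 := (map_ofNat C 2).symm
    rw [hp, this, ← mul_assoc, ← C_mul]
    norm_num
  let P : Matrix (Fin 1) (Fin α) (MvPolynomial (Fin n) ℝ) := fun _ => p • (C ∘ u) + l • (C ∘ w)
  refine hV _ ⟨Pᵀ * P, isQuadraticSosMatrix_transpose_mul P fun _ i => ?_, ?_⟩
  · have : ∀ {q : MvPolynomial (Fin n) ℝ} (c : ℝ), q.totalDegree ≤ 1 → (q * C c).totalDegree ≤ 1 :=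
      fun c hq => (totalDegree_mul _ _).trans (by rwa [totalDegree_C, add_zero])
    refine (totalDegree_add _ _).trans (max_le ?_ ?_)
    · exact this _ hpd
    · exact this _ hld
  · have : polyOfVec n 1 (pairVec A u w) ^ 2 + (A * (Pᵀ * P)).trace
        = p ^ 2 * polyOfVec n 1 (pairVec A u u) := by
      rw [trace_mul_transpose_mul, Fin.sum_univ_one]
      simp only [P, mulVec_add, mulVec_smul, dotProduct_add, add_dotProduct, smul_dotProduct,
        dotProduct_smul, ← polyOfVec_pairVec hA, pairVec_comm hA w u, ← hl, ← hm, smul_eq_mul]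
      linear_combination l ^ 2 * h2p
    rw [this]
    refine mul_mem_rowPolys ((totalDegree_pow _ _).trans ?_) hu
    omega

/-- Modulo V the pencil behaves like a positive semidefinite one: a sum of nonnegative terms can
vanish only term by term. It excludes both -1 from the cone and kernel vectors of its
parametrization. -/
lemma eq_zero_and_pairVec_self_mem (hA : IsLinearPencil A) (hV : ∀ h, IsStep A V h → h ∈ V)
    (h1 : oneVec n 1 ∉ V) {c : ℝ} (hc : 0 ≤ c) (B : Matrix (Fin α) (Fin α) ℝ)
    (h : c • oneVec n 1 + ∑ k, pairVec A (B k) (B k) ∈ V) :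
    c = 0 ∧ ∀ k, pairVec A (B k) (B k) ∈ V := by
  classical
  have hc0 : c = 0 := by
    by_contra hne
    have hs : Real.sqrt c ≠ 0 := Real.sqrt_ne_zero'.2 (lt_of_le_of_ne hc (Ne.symm hne))
    have : Real.sqrt c • oneVec n 1 ∈ V := by
      -- With T = B*B, the square of √c plus tr(A T) is the given element of V.
      refine hV _ ⟨(B.map C)ᵀ * B.map C, isQuadraticSosMatrix_transpose_mul _ (by simp), ?_⟩
      have e : polyOfVec n 1 (Real.sqrt c • oneVec n 1) ^ 2 + (A * ((B.map C)ᵀ * B.map C)).trace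
          = polyOfVec n 1 (c • oneVec n 1 + ∑ k, pairVec A (B k) (B k)) := by
        rw [trace_mul_transpose_mul, map_add, map_sum, map_smul, map_smul, smul_pow,
          Real.sq_sqrt hc]
        simp only [polyOfVec_pairVec hA, polyOfVec_oneVec, one_pow]
        rfl
      rw [e]
      exact polyOfVec_mem_rowPolys h
    exact h1 ((V.smul_mem_iff hs).1 this)
  refine ⟨hc0, fun k₀ => ?_⟩
  rw [hc0, zero_smul, zero_add] at h
  set l := polyOfVec n 1 (pairVec A (B k₀) (B k₀)) with hl
  have hld : l.totalDegree ≤ 1 := totalDegree_polyOfVec_le _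
  -- Since ((l + 1)/2)² - ((l - 1)/2)² = l, weighting the summand k₀ differently from the others
  -- gives tr(A T) = ((l + 1)/2)² times the whole sum, minus l · l.
  let r : Fin α → MvPolynomial (Fin n) ℝ := fun k =>
    C (1 / 2) * (if k = k₀ then l - 1 else l + 1)
  have hrd : ∀ k, (r k).totalDegree ≤ 1 := fun k => by
    refine (totalDegree_mul _ _).trans ?_
    rw [totalDegree_C, zero_add]
    split_ifs
    · exact (totalDegree_sub _ _).trans (by simpa using hld)
    · exact (totalDegree_add _ _).trans (by simpa using hld)
  have hr'd : (C (1 / 2) * (l + 1)).totalDegree ≤ 1 := by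
    refine (totalDegree_mul _ _).trans ?_
    rw [totalDegree_C, zero_add]
    exact (totalDegree_add _ _).trans (by simpa using hld)
  let P : Matrix (Fin α) (Fin α) (MvPolynomial (Fin n) ℝ) := fun k => r k • (C ∘ B k)
  refine hV _ ⟨Pᵀ * P, isQuadraticSosMatrix_transpose_mul P fun k i => ?_, ?_⟩
  · exact (totalDegree_mul _ _).trans (by rw [Function.comp, totalDegree_C, add_zero]; exact hrd k)
  · have e : polyOfVec n 1 (pairVec A (B k₀) (B k₀)) ^ 2 + (A * (Pᵀ * P)).trace
        = (C (1 / 2) * (l + 1)) ^ 2 * polyOfVec n 1 (∑ k, pairVec A (B k) (B k)) := by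
      have h4 : (C (1 / 2) : MvPolynomial (Fin n) ℝ) ^ 2 * 4 = 1 := by
        have : (4 : MvPolynomial (Fin n) ℝ) = C 4 := (map_ofNat C 4).symm
        rw [this, ← C_pow, ← C_mul]
        norm_num
      rw [trace_mul_transpose_mul, map_sum, Finset.mul_sum,
        ← Finset.add_sum_erase _ _ (Finset.mem_univ k₀),
        ← Finset.add_sum_erase _ _ (Finset.mem_univ k₀)]
      have hP : ∀ k, P k ⬝ᵥ A *ᵥ P k = r k ^ 2 * polyOfVec n 1 (pairVec A (B k) (B k)) := by
        intro k
        simp only [P, mulVec_smul, smul_dotProduct, dotProduct_smul, ← polyOfVec_pairVec hA,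
          smul_eq_mul]
        ring
      have hsum : ∑ k ∈ Finset.univ.erase k₀, P k ⬝ᵥ A *ᵥ P k =
          ∑ k ∈ Finset.univ.erase k₀,
            (C (1 / 2) * (l + 1)) ^ 2 * polyOfVec n 1 (pairVec A (B k) (B k)) :=
        Finset.sum_congr rfl fun k hk => by
          rw [hP]
          simp only [r, if_neg (Finset.ne_of_mem_erase hk)]
      rw [hsum, hP, ← hl]
      simp only [r, if_true]
      linear_combination -l ^ 2 * h4
    rw [e]
    refine mul_mem_rowPolys ((totalDegree_pow _ _).trans ?_) h
    omega

end pencil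
end SosDuality
end

noncomputable section
namespace SosDuality
open MvPolynomial Matrix

variable {n α : ℕ} {A : Matrix (Fin α) (Fin α) (MvPolynomial (Fin n) ℝ)}
  {V : Submodule ℝ (MonomialIndex n 1 → ℝ)}

/-! ### Certificates modulo a subspace -/

/-- The coefficient vectors of the polynomials `c + tr (A S) + v` with `c ≥ 0`, `S` positive
semidefinite and `v ∈ V`. -/
def certificateCone (A : Matrix (Fin α) (Fin α) (MvPolynomial (Fin n) ℝ))
    (V : Submodule ℝ (MonomialIndex n 1 → ℝ)) : Set (MonomialIndex n 1 → ℝ) :=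
  {g | ∃ c : ℝ, 0 ≤ c ∧ ∃ S : Matrix (Fin α) (Fin α) ℝ, S.PosSemidef ∧ ∃ v ∈ V,
    g = c • oneVec n 1 + traceVec A S + v}

lemma zero_mem_certificateCone : 0 ∈ certificateCone A V :=
  ⟨0, le_rfl, 0, .zero, 0, V.zero_mem, by
    rw [show traceVec A (0 : Matrix (Fin α) (Fin α) ℝ) = 0 from map_zero (traceVec A)]
    simp⟩

lemma mem_certificateCone_of_mem {v : MonomialIndex n 1 → ℝ} (hv : v ∈ V) :
    v ∈ certificateCone A V :=
  ⟨0, le_rfl, 0, .zero, v, hv, by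
    rw [show traceVec A (0 : Matrix (Fin α) (Fin α) ℝ) = 0 from map_zero (traceVec A)]
    simp⟩

lemma oneVec_mem_certificateCone : oneVec n 1 ∈ certificateCone A V :=
  ⟨1, zero_le_one, 0, .zero, 0, V.zero_mem, by
    rw [show traceVec A (0 : Matrix (Fin α) (Fin α) ℝ) = 0 from map_zero (traceVec A)]
    simp⟩

lemma traceVec_vecMulVec (u : Fin α → ℝ) : traceVec A (vecMulVec u u) = pairVec A u u := by
  rw [traceVec_apply A (vecMulVec u u)]
  simp only [vecMulVec_apply, pairVec, mul_comm]

lemma pairVec_mem_certificateCone (u : Fin α → ℝ) : pairVec A u u ∈ certificateCone A V :=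
  ⟨0, le_rfl, vecMulVec u u, posSemidef_vecMulVec_self_star u, 0, V.zero_mem, by
    rw [traceVec_vecMulVec]; simp⟩

lemma add_mem_certificateCone {g g' : MonomialIndex n 1 → ℝ} (h : g ∈ certificateCone A V)
    (h' : g' ∈ certificateCone A V) : g + g' ∈ certificateCone A V := by
  obtain ⟨c, hc, S, hS, v, hv, rfl⟩ := h
  obtain ⟨c', hc', S', hS', v', hv', rfl⟩ := h'
  refine ⟨c + c', add_nonneg hc hc', S + S', hS.add hS', v + v', V.add_mem hv hv', ?_⟩
  rw [show traceVec A (S + S') = traceVec A S + traceVec A S' from map_add (traceVec A) S S',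
    add_smul]
  abel

lemma smul_mem_certificateCone {g : MonomialIndex n 1 → ℝ} (h : g ∈ certificateCone A V) {r : ℝ}
    (hr : 0 ≤ r) : r • g ∈ certificateCone A V := by
  obtain ⟨c, hc, S, hS, v, hv, rfl⟩ := h
  refine ⟨r * c, mul_nonneg hr hc, r • S, hS.smul hr, r • v, V.smul_mem r hv, ?_⟩
  rw [show traceVec A (r • S) = r • traceVec A S from map_smul (traceVec A) r S]
  simp [smul_add, mul_smul]

/-- The vectors `u` for which all entries of `A u` lie in `V`. -/
def pencilKernel (A : Matrix (Fin α) (Fin α) (MvPolynomial (Fin n) ℝ))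
    (V : Submodule ℝ (MonomialIndex n 1 → ℝ)) : Submodule ℝ (Fin α → ℝ) where
  carrier := {u | ∀ w, pairVec A u w ∈ V}
  add_mem' hu hu' w := by
    rw [pairVec_add_left]
    exact V.add_mem (hu w) (hu' w)
  zero_mem' w := by simp [pairVec]
  smul_mem' c u hu w := by
    rw [pairVec_smul_left]
    exact V.smul_mem c (hu w)

/-- The triples `(c, S, v)` with `S` vanishing on the kernel of the pencil. -/
def reducedCone (A : Matrix (Fin α) (Fin α) (MvPolynomial (Fin n) ℝ))
    (V : Submodule ℝ (MonomialIndex n 1 → ℝ)) : Set (ℝ × (Fin α → Fin α → ℝ) × V) :=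
  {d | 0 ≤ d.1 ∧ (Matrix.of d.2.1).PosSemidef ∧ ∀ u ∈ pencilKernel A V, Matrix.of d.2.1 *ᵥ u = 0}

lemma isClosed_reducedCone : IsClosed (reducedCone A V) := by
  refine (isClosed_le continuous_const continuous_fst).inter (.inter ?_ ?_)
  · exact (isClosed_setOf_posSemidef (Fin α)).preimage (continuous_fst.comp continuous_snd)
  · have : {d : ℝ × (Fin α → Fin α → ℝ) × V | ∀ u ∈ pencilKernel A V, Matrix.of d.2.1 *ᵥ u = 0} =
        ⋂ u : pencilKernel A V, {d | (fun i => ∑ j, d.2.1 i j * u.1 j) = 0} := by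
      ext d
      simp only [Set.mem_iInter, Subtype.forall]
      rfl
    change IsClosed {d : ℝ × (Fin α → Fin α → ℝ) × V |
      ∀ u ∈ pencilKernel A V, Matrix.of d.2.1 *ᵥ u = 0}
    rw [this]
    refine isClosed_iInter fun u => isClosed_eq (by fun_prop) continuous_const

/-- The parametrization of the certificate cone, as a linear map. -/
def certificateMap (A : Matrix (Fin α) (Fin α) (MvPolynomial (Fin n) ℝ))
    (V : Submodule ℝ (MonomialIndex n 1 → ℝ)) :
    (ℝ × (Fin α → Fin α → ℝ) × V) →ₗ[ℝ] (MonomialIndex n 1 → ℝ) :=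
  (LinearMap.toSpanSingleton ℝ _ (oneVec n 1)).coprod ((traceVec A).coprod V.subtype)

lemma certificateMap_apply (d : ℝ × (Fin α → Fin α → ℝ) × V) :
    certificateMap A V d = d.1 • oneVec n 1 + traceVec A d.2.1 + d.2.2 := by
  simp [certificateMap, add_assoc]

/-- Write S = B*B and replace each row of B by its component orthogonal to `pencilKernel A V`. This
changes tr(A S) only by an element of V, and it removes the directions in which the parametrization
could degenerate. -/
lemma certificateCone_eq_image (hA : IsLinearPencil A) :
    certificateCone A V = certificateMap A V '' reducedCone A V := by
  apply Set.Subset.antisymm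
  · rintro _ ⟨c, hc, S, hS, v, hv, rfl⟩
    obtain ⟨B, rfl⟩ := posSemidef_iff_exists_transpose_mul.1 hS
    choose k hk p hp hkp using fun i => exists_add_of_submodule (pencilKernel A V) (B i)
    have hdiff : ∀ i, pairVec A (B i) (B i) - pairVec A (p i) (p i) ∈ V := fun i => by
      have : pairVec A (B i) (B i) - pairVec A (p i) (p i)
          = pairVec A (k i) (B i) + pairVec A (k i) (p i) := by
        conv_lhs => rw [hkp i, pairVec_add_left, pairVec_comm hA (p i), pairVec_add_left]
        rw [← hkp i]
        abel
      rw [this]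
      exact V.add_mem (hk i _) (hk i _)
    set Q : Matrix (Fin α) (Fin α) ℝ := p with hQ
    have hsum : traceVec A (Bᵀ * B) - traceVec A (Qᵀ * Q) ∈ V := by
      rw [traceVec_transpose_mul, traceVec_transpose_mul, ← Finset.sum_sub_distrib]
      exact V.sum_mem fun i _ => hdiff i
    refine ⟨(c, Qᵀ * Q, ⟨_, V.add_mem hv hsum⟩), ⟨hc, posSemidef_transpose_mul_self Q, ?_⟩, ?_⟩
    · intro u hu
      change (Qᵀ * Q) *ᵥ u = 0
      rw [← mulVec_mulVec]
      have : Q *ᵥ u = 0 := funext fun i => hp i u hu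
      rw [this, mulVec_zero]
    · rw [certificateMap_apply]
      dsimp only
      abel
  · rintro _ ⟨⟨c, S, v⟩, ⟨hc, hS, -⟩, rfl⟩
    exact ⟨c, hc, S, hS, v, v.2, certificateMap_apply _⟩

/-- By `isClosed_image_of_cone` it suffices that the parametrization has no nonzero zero on the
reduced cone. If c + Σ bₖ*A bₖ + v = 0 with S = B*B, then c = 0 and every row bₖ lies in the pencil
kernel. Hence B*B bₖ = 0 and B bₖ = 0, whose k-th entry is |bₖ|². -/
lemma isClosed_certificateCone (hA : IsLinearPencil A) (hV : ∀ h, IsStep A V h → h ∈ V)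
    (h1 : oneVec n 1 ∉ V) : IsClosed (certificateCone A V) := by
  rw [certificateCone_eq_image hA]
  refine isClosed_image_of_cone (certificateMap A V).toContinuousLinearMap isClosed_reducedCone
    ?_ ?_
  · rintro c hc ⟨a, S, v⟩ ⟨ha, hS, hK⟩
    refine ⟨mul_nonneg hc ha, hS.smul hc, fun u hu => ?_⟩
    change (c • Matrix.of S) *ᵥ u = 0
    rw [smul_mulVec, hK u hu, smul_zero]
  · rintro ⟨c, S, v⟩ ⟨hc, hS, hK⟩ h0
    rw [LinearMap.coe_toContinuousLinearMap', certificateMap_apply] at h0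
    dsimp only at hc hS hK h0
    obtain ⟨B, hB⟩ := posSemidef_iff_exists_transpose_mul.1 hS
    have hS' : S = Bᵀ * B := hB
    rw [hS', traceVec_transpose_mul] at h0
    have hmem : c • oneVec n 1 + ∑ k, pairVec A (B k) (B k) ∈ V := by
      rw [eq_neg_of_add_eq_zero_left h0]
      exact V.neg_mem v.2
    obtain ⟨hc0, hk⟩ := eq_zero_and_pairVec_self_mem hA hV h1 hc B hmem
    have hB0 : B = 0 := by
      ext k j
      have hker : B k ∈ pencilKernel A V := fun w => pairVec_mem_of_pairVec_self_mem hA hV (hk k) w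
      have h2 := hK _ hker
      rw [hB, ← mulVec_mulVec] at h2
      have h3 : (B *ᵥ B k) ⬝ᵥ (B *ᵥ B k) = 0 := by
        rw [dotProduct_mulVec, ← mulVec_transpose, h2, zero_dotProduct]
      have h4 : B k ⬝ᵥ B k = 0 := congrFun (dotProduct_self_eq_zero.1 h3) k
      exact congrFun (dotProduct_self_eq_zero.1 h4) j
    subst hc0
    have hS0 : S = 0 := by rw [hS', hB0, Matrix.mul_zero]; rfl
    have hv0 : v = 0 := by
      rw [hB0] at h0
      refine Subtype.ext ?_
      simpa [pairVec] using h0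
    rw [hS0, hv0]
    rfl

/-- A functional nonnegative on the cone vanishes on V and is nonnegative on all u*Au. Once it is
normalized to 1 at the constant 1, it is evaluation at a point of the spectrahedron where V
vanishes. -/
lemma mem_certificateCone_of_nonneg (hA : IsLinearPencil A) (hV : ∀ h, IsStep A V h → h ∈ V)
    (h1 : oneVec n 1 ∉ V) {f : MonomialIndex n 1 → ℝ}
    (hf : ∀ x ∈ spectrahedron A, (∀ g ∈ V, eval x (polyOfVec n 1 g) = 0) →
      0 ≤ eval x (polyOfVec n 1 f)) : f ∈ certificateCone A V := by
  have hclosed := isClosed_certificateCone hA hV h1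
  have hneg : -oneVec n 1 ∉ certificateCone A V := by
    rintro ⟨c, hc, S, hS, v, hv, e⟩
    obtain ⟨B, rfl⟩ := posSemidef_iff_exists_transpose_mul.1 hS
    rw [traceVec_transpose_mul] at e
    have : (c + 1) • oneVec n 1 + ∑ k, pairVec A (B k) (B k) ∈ V := by
      have h2 : (c + 1) • oneVec n 1 + ∑ k, pairVec A (B k) (B k) = -v := by
        rw [add_smul, one_smul]
        linear_combination -e
      rw [h2]
      exact V.neg_mem hv
    have := (eq_zero_and_pairVec_self_mem hA hV h1 (by positivity) B this).1
    linarith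
  by_contra hfC
  obtain ⟨φ, hφ, hφf⟩ := exists_dual_of_notMem_closed_cone hclosed zero_mem_certificateCone
    (fun _ hx _ hy => add_mem_certificateCone hx hy)
    (fun _ hc _ hx => smul_mem_certificateCone hx hc) hfC
  obtain ⟨χ, hχ, hχ1⟩ := exists_dual_of_notMem_closed_cone hclosed zero_mem_certificateCone
    (fun _ hx _ hy => add_mem_certificateCone hx hy)
    (fun _ hc _ hx => smul_mem_certificateCone hx hc) hneg
  rw [map_neg, neg_lt_zero] at hχ1
  -- The functional φ may vanish at 1, so it need not be a multiple of an evaluation. Adding εχ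
  -- repairs this, with ε so small that the value at f stays at most φ(f)/2 < 0.
  obtain ⟨ε, hε, hεf⟩ : ∃ ε : ℝ, 0 < ε ∧ φ f + ε * χ f < 0 := by
    refine ⟨-φ f / (2 * (|χ f| + 1)), by have := neg_pos.2 hφf; positivity, ?_⟩
    have h2 : 0 < |χ f| + 1 := by positivity
    have h3 : χ f ≤ |χ f| + 1 := (le_abs_self _).trans (by linarith)
    have h4 : -φ f / (2 * (|χ f| + 1)) * χ f ≤ -φ f / (2 * (|χ f| + 1)) * (|χ f| + 1) :=
      mul_le_mul_of_nonneg_left h3 (by have := neg_pos.2 hφf; positivity)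
    have h5 : -φ f / (2 * (|χ f| + 1)) * (|χ f| + 1) = -φ f / 2 := by field_simp
    linarith
  have hpos : ∀ g ∈ certificateCone A V, 0 ≤ (φ + ε • χ) g := fun g hg =>
    add_nonneg (hφ g hg) (mul_nonneg hε.le (hχ g hg))
  set t := (φ + ε • χ) (oneVec n 1) with ht
  have ht0 : 0 < t :=
    add_pos_of_nonneg_of_pos (hφ _ oneVec_mem_certificateCone) (mul_pos hε hχ1)
  obtain ⟨x, hx⟩ := exists_eval_eq (t⁻¹ • (φ + ε • χ)) (by
    rw [LinearMap.smul_apply, ← ht, smul_eq_mul, inv_mul_cancel₀ ht0.ne'])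
  have hev : ∀ g ∈ certificateCone A V, 0 ≤ eval x (polyOfVec n 1 g) := fun g hg => by
    rw [hx]
    exact mul_nonneg (inv_nonneg.2 ht0.le) (hpos g hg)
  have hfx := hf x ((mem_spectrahedron_iff hA).2 fun u => hev _ (pairVec_mem_certificateCone u))
    fun g hg => le_antisymm
      (by simpa using hev _ (mem_certificateCone_of_mem (V.neg_mem hg)))
      (hev _ (mem_certificateCone_of_mem hg))
  rw [hx] at hfx
  have : t⁻¹ * (φ f + ε * χ f) < 0 := mul_neg_of_pos_of_neg (inv_pos.2 ht0) hεf
  exact absurd hfx (not_le.2 this)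

/-- If the zero set of `V` is a single point, then the certificate exists. -/
lemma mem_certificateCone_of_finrank (hA : IsLinearPencil A) (h1 : oneVec n 1 ∉ V)
    (hn : n ≤ Module.finrank ℝ V) {f : MonomialIndex n 1 → ℝ}
    (hf : ∀ x ∈ spectrahedron A, (∀ g ∈ V, eval x (polyOfVec n 1 g) = 0) →
      0 ≤ eval x (polyOfVec n 1 f)) : f ∈ certificateCone A V := by
  obtain ⟨φ', hφ', hφV'⟩ := Submodule.exists_dual_map_eq_bot_of_notMem h1 inferInstance
  set φ : (MonomialIndex n 1 → ℝ) →ₗ[ℝ] ℝ := (φ' (oneVec n 1))⁻¹ • φ' with hφ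
  have hφ1 : φ (oneVec n 1) = 1 := by simp [hφ, hφ']
  have hVker : V ≤ LinearMap.ker φ := fun v hv => by
    have : φ' v ∈ V.map φ' := Submodule.mem_map_of_mem hv
    rw [hφV', Submodule.mem_bot] at this
    simp [hφ, this]
  -- The linear polynomials have dimension at most n + 1, so V is a hyperplane and φ is evaluation
  -- at its only common zero.
  have hker : LinearMap.ker φ = V := by
    refine (Submodule.eq_of_le_of_finrank_le hVker ?_).symm
    have h2 := LinearMap.finrank_range_add_finrank_ker φ
    have h3 : LinearMap.range φ = ⊤ := LinearMap.range_eq_top.2 fun c =>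
      ⟨c • oneVec n 1, by simp [hφ1]⟩
    have h4 : Fintype.card (MonomialIndex n 1) ≤ n + 1 := by
      simpa using card_monomialIndex_le n 1
    rw [h3, finrank_top, Module.finrank_self, Module.finrank_fintype_fun_eq_card] at h2
    omega
  obtain ⟨x, hx⟩ := exists_eval_eq φ hφ1
  have hVx : ∀ g ∈ V, eval x (polyOfVec n 1 g) = 0 := fun g hg => by
    rw [hx]
    exact hVker hg
  have hdec : ∀ g, g - φ g • oneVec n 1 ∈ V := fun g => by
    rw [← hker, LinearMap.mem_ker, map_sub, map_smul, hφ1]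
    simp
  rcases le_or_gt 0 (φ f) with h0 | h0
  · have := add_mem_certificateCone (A := A) (smul_mem_certificateCone oneVec_mem_certificateCone h0)
      (mem_certificateCone_of_mem (hdec f))
    simpa using this
  -- The point x violates the pencil in some direction u. A nonnegative multiple of u*Au then agrees
  -- with f at x, hence modulo V.
  · have hnx : x ∉ spectrahedron A := fun h => by
      have := hf x h hVx
      rw [hx] at this
      exact absurd this (not_le.2 h0)
    rw [mem_spectrahedron_iff hA] at hnx
    push Not at hnx
    obtain ⟨u, hu⟩ := hnx
    rw [hx] at hu
    have hr : 0 ≤ φ f / φ (pairVec A u u) := (div_pos_of_neg_of_neg h0 hu).le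
    have h2 : f - (φ f / φ (pairVec A u u)) • pairVec A u u ∈ V := by
      rw [← hker, LinearMap.mem_ker, map_sub, map_smul, smul_eq_mul, div_mul_cancel₀ _ hu.ne,
        sub_self]
    have := add_mem_certificateCone (A := A)
      (smul_mem_certificateCone (pairVec_mem_certificateCone u) hr)
      (mem_certificateCone_of_mem h2)
    simpa using this

/-! ### The certificate -/

/-- As long as 1 is not in V and some new h exists, the dimension grows by at least one per step. -/
lemma exists_reachable_subspace (A : Matrix (Fin α) (Fin α) (MvPolynomial (Fin n) ℝ)) (k : ℕ) :
    ∃ V : Submodule ℝ (MonomialIndex n 1 → ℝ),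
      (∀ W : Matrix (MonomialIndex n 2) (MonomialIndex n 1) ℝ, (∀ p, W p ∈ V) →
        Reachable A k W) ∧
      (oneVec n 1 ∈ V ∨ (∀ h, IsStep A V h → h ∈ V) ∨ k ≤ Module.finrank ℝ V) := by
  induction k with
  | zero => exact ⟨⊥, fun W hW => funext hW, .inr (.inr (Nat.zero_le _))⟩
  | succ k ih =>
    obtain ⟨V, hV, h⟩ := ih
    by_cases hs : oneVec n 1 ∈ V ∨ ∀ h, IsStep A V h → h ∈ V
    -- The chain must have exact length k + 1, so it is padded by the trivial step h = 0, which
    -- leaves V unchanged.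
    · refine ⟨V, fun W hW => reachable_succ hV (isStep_zero A V) W (by simpa using hW), ?_⟩
      rcases hs with hs | hs
      exacts [.inl hs, .inr (.inl hs)]
    · rw [not_or] at hs
      have hk : k ≤ Module.finrank ℝ V := (h.resolve_left hs.1).resolve_left hs.2
      obtain ⟨g, hg⟩ := not_forall.1 hs.2
      rw [Classical.not_imp] at hg
      refine ⟨V ⊔ Submodule.span ℝ {g}, reachable_succ hV hg.1, .inr (.inr ?_)⟩
      refine Nat.succ_le_of_lt (hk.trans_lt (Submodule.finrank_lt_finrank_of_lt ?_))
      refine lt_of_le_of_ne le_sup_left fun h => hg.2 ?_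
      rw [h]
      exact Submodule.mem_sup_right (Submodule.mem_span_singleton_self g)

/-- The certificate of nonnegativity, with the matrices of the chain collected in `Reachable`. -/
lemma exists_reachable_of_nonneg (hA : IsLinearPencil A) {f : MvPolynomial (Fin n) ℝ}
    (hf : IsLinearPoly f) (h : ∀ x ∈ spectrahedron A, 0 ≤ eval x f) :
    ∃ W, Reachable A n W ∧ ∃ S : Matrix (Fin α) (Fin α) ℝ, S.PosSemidef ∧ ∃ c : ℝ, 0 ≤ c ∧
      f - C c + polyOfMatrix W - (A * S.map C).trace = 0 := by
  obtain ⟨V, hV, hcase⟩ := exists_reachable_subspace A n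
  have hfx : ∀ x ∈ spectrahedron A, (∀ g ∈ V, eval x (polyOfVec n 1 g) = 0) →
      0 ≤ eval x (polyOfVec n 1 (coeffVec n 1 f)) := fun x hx _ => by
    rw [polyOfVec_coeffVec hf]
    exact h x hx
  by_cases h1 : oneVec n 1 ∈ V
  -- When 1 lies in V, the last W alone can represent -f, with S = 0 and c = 0.
  · have : f * polyOfVec n 1 (oneVec n 1) ∈ rowPolys V :=
      mul_mem_rowPolys (le_trans hf one_le_two) h1
    obtain ⟨W, hW, e⟩ := mem_rowPolys.1 ((rowPolys V).neg_mem this)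
    refine ⟨W, hV W hW, 0, .zero, 0, le_rfl, ?_⟩
    rw [e]
    simp
  · have hmem : coeffVec n 1 f ∈ certificateCone A V := by
      rcases hcase.resolve_left h1 with h2 | h2
      · exact mem_certificateCone_of_nonneg hA h2 h1 hfx
      · exact mem_certificateCone_of_finrank hA h1 h2 hfx
    obtain ⟨c, hc, S, hS, v, hv, e⟩ := hmem
    obtain ⟨W, hW, e'⟩ := mem_rowPolys.1 (polyOfVec_mem_rowPolys (V.neg_mem hv))
    refine ⟨W, hV W hW, S, hS, c, hc, ?_⟩
    have e2 := congrArg (polyOfVec n 1) e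
    rw [polyOfVec_coeffVec hf, map_add, map_add, polyOfVec_traceVec hA, map_smul,
      polyOfVec_oneVec, smul_eq_C_mul, mul_one] at e2
    rw [e', e2, map_neg]
    abel

/-! ### Soundness and strong duality -/

lemma trace_eval_nonneg {T : Matrix (Fin α) (Fin α) (MvPolynomial (Fin n) ℝ)} (hT : IsSosMatrix T)
    {x : Fin n → ℝ} (hx : x ∈ spectrahedron A) : 0 ≤ eval x (A * T).trace := by
  obtain ⟨s, P, rfl⟩ := hT
  rw [trace_mul_transpose_mul, map_sum]
  refine Finset.sum_nonneg fun k _ => ?_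
  have := hx.dotProduct_mulVec_nonneg fun i => eval x (P k i)
  simpa [dotProduct, mulVec] using this

lemma isSosMatrix_map_C {S : Matrix (Fin α) (Fin α) ℝ} (hS : S.PosSemidef) :
    IsSosMatrix (S.map C : Matrix (Fin α) (Fin α) (MvPolynomial (Fin n) ℝ)) := by
  obtain ⟨B, rfl⟩ := posSemidef_iff_exists_transpose_mul.1 hS
  exact ⟨α, B.map C, by rw [Matrix.map_mul, transpose_map]⟩

lemma eval_polyOfMatrix {e d : ℕ} (W : Matrix (MonomialIndex n e) (MonomialIndex n d) ℝ)
    (x : Fin n → ℝ) : eval x (polyOfMatrix W)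
      = (fun p => eval x (monomialVec n e p)) ⬝ᵥ W *ᵥ fun q => eval x (monomialVec n d q) := by
  simp [polyOfMatrix, dotProduct, mulVec]

/-- Along the chain every Wᵢ annihilates the vector of monomials of degree at most one at x: the
step equation makes the quadratic form of Uᵢ nonpositive there, while Uᵢ dominates Wᵢ*Wᵢ. -/
lemma SosDualFeasible.le_eval {l : MvPolynomial (Fin n) ℝ} {a : ℝ}
    {S : Matrix (Fin α) (Fin α) ℝ}
    {T : Fin n → Matrix (Fin α) (Fin α) (MvPolynomial (Fin n) ℝ)}
    {U : Fin n → Matrix (MonomialIndex n 1) (MonomialIndex n 1) ℝ}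
    {W : Fin (n + 1) → Matrix (MonomialIndex n 2) (MonomialIndex n 1) ℝ}
    (h : SosDualFeasible A l a S T U W) {x : Fin n → ℝ} (hx : x ∈ spectrahedron A) :
    a ≤ eval x l := by
  have hW : ∀ i, W i *ᵥ (fun q => eval x (monomialVec n 1 q)) = 0 := by
    intro i
    induction i using Fin.induction with
    | zero => rw [h.zero, zero_mulVec]
    | succ i ih =>
      have h1 := congrArg (eval x) (h.step i)
      rw [map_add, map_add, eval_polyOfMatrix, eval_polyOfMatrix, ih, dotProduct_zero, add_zero,
        map_zero] at h1
      have h2 := trace_eval_nonneg (h.sos i).1 hx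
      have h3 := (h.dominates i).dotProduct_mulVec_nonneg fun q => eval x (monomialVec n 1 q)
      rw [star_trivial, sub_mulVec, dotProduct_sub, ← mulVec_mulVec,
        dotProduct_mulVec _ (W i.succ)ᵀ, vecMul_transpose] at h3
      have h4 : 0 ≤ (W i.succ *ᵥ fun q => eval x (monomialVec n 1 q)) ⬝ᵥ
          (W i.succ *ᵥ fun q => eval x (monomialVec n 1 q)) :=
        Finset.sum_nonneg fun _ _ => mul_self_nonneg _
      exact dotProduct_self_eq_zero.1 (by linarith)
  have h1 := congrArg (eval x) h.final
  have h2 := trace_eval_nonneg (isSosMatrix_map_C (n := n) h.posSemidef) hx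
  rw [map_sub, map_add, map_sub, eval_polyOfMatrix, hW, dotProduct_zero, eval_C, map_zero] at h1
  linarith

/-- The certificate of ℓ - r has a constant c ≥ 0, which is absorbed into the objective a = r + c.
Allowing r equal to the primal value is what yields attainment. -/
lemma exists_feasible_of_le (hA : IsLinearPencil A) {l : MvPolynomial (Fin n) ℝ}
    (hl : IsLinearPoly l) {r : ℝ} (hr : (r : EReal) ≤ primalValue A l) :
    ∃ q ∈ sosDualFeasibleSet A l, r ≤ q.1 := by
  obtain ⟨W, hW, S, hS, c, hc, e⟩ := exists_reachable_of_nonneg hA (f := l - C r)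
    ((totalDegree_sub _ _).trans (by simpa using show l.totalDegree ≤ 1 from hl)) fun x hx => by
      have : (r : EReal) ≤ (eval x l : ℝ) := hr.trans (iInf₂_le x hx)
      rw [map_sub, eval_C, sub_nonneg]
      exact_mod_cast this
  obtain ⟨T, U, W', hT, hU, h0, hs, hd, hlast⟩ := hW.exists_chain
  refine ⟨(r + c, S, T, U, W'), ⟨hS, hT, hU, h0, hs, hd, ?_⟩, le_add_of_nonneg_right hc⟩
  dsimp only
  rw [hlast, C_add, ← e]
  ring

lemma sosDualValue_le_primalValue (A : Matrix (Fin α) (Fin α) (MvPolynomial (Fin n) ℝ))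
    (l : MvPolynomial (Fin n) ℝ) : sosDualValue A l ≤ primalValue A l :=
  iSup₂_le fun _ hq => le_iInf₂ fun _ hx => EReal.coe_le_coe_iff.2 (SosDualFeasible.le_eval hq hx)

theorem primalValue_eq_sosDualValue (hA : IsLinearPencil A) {l : MvPolynomial (Fin n) ℝ}
    (hl : IsLinearPoly l) : primalValue A l = sosDualValue A l := by
  -- Testing against real r below the primal value covers the infinite cases too: all r if the value
  -- is ∞, none if it is -∞.
  refine le_antisymm (EReal.ge_of_forall_gt_iff_ge.1 fun r hr => ?_)
    (sosDualValue_le_primalValue A l)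
  obtain ⟨q, hq, hrq⟩ := exists_feasible_of_le hA hl hr.le
  exact (EReal.coe_le_coe_iff.2 hrq).trans (le_iSup₂ (f := fun q _ => ((q.1 : ℝ) : EReal)) q hq)

theorem exists_feasible_eq_sosDualValue (hA : IsLinearPencil A) {l : MvPolynomial (Fin n) ℝ}
    (hl : IsLinearPoly l) {r : ℝ} (hr : sosDualValue A l = r) :
    ∃ q ∈ sosDualFeasibleSet A l, q.1 = r := by
  obtain ⟨q, hq, hrq⟩ := exists_feasible_of_le hA hl
    (hr.symm.trans (primalValue_eq_sosDualValue hA hl).symm).le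
  refine ⟨q, hq, le_antisymm ?_ hrq⟩
  rw [← EReal.coe_le_coe_iff, ← hr]
  exact le_iSup₂ (f := fun q _ => ((q.1 : ℝ) : EReal)) q hq

theorem nonneg_on_spectrahedron_iff (hA : IsLinearPencil A) {f : MvPolynomial (Fin n) ℝ}
    (hf : IsLinearPoly f) : (∀ x ∈ spectrahedron A, 0 ≤ eval x f) ↔
      ∃ (T : Fin n → Matrix (Fin α) (Fin α) (MvPolynomial (Fin n) ℝ))
        (U : Fin n → Matrix (MonomialIndex n 1) (MonomialIndex n 1) ℝ)
        (W : Fin (n + 1) → Matrix (MonomialIndex n 2) (MonomialIndex n 1) ℝ)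
        (S : Matrix (Fin α) (Fin α) ℝ) (c : ℝ),
        (∀ i, IsQuadraticSosMatrix (T i)) ∧ (∀ i, (U i).IsSymm) ∧ W 0 = 0 ∧
        S.PosSemidef ∧ 0 ≤ c ∧
        (∀ i : Fin n,
          polyOfMatrix (U i) + polyOfMatrix (W i.castSucc) + (A * T i).trace = 0) ∧
        (∀ i : Fin n, (U i - (W i.succ).transpose * W i.succ).PosSemidef) ∧
        f - MvPolynomial.C c + polyOfMatrix (W (Fin.last n))
          - (A * S.map MvPolynomial.C).trace = 0 := by
  constructor
  · intro h
    obtain ⟨W, hW, S, hS, c, hc, e⟩ := exists_reachable_of_nonneg hA hf h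
    obtain ⟨T, U, W', hT, hU, h0, hs, hd, hlast⟩ := hW.exists_chain
    exact ⟨T, U, W', S, c, hT, hU, h0, hS, hc, hs, hd, by rw [hlast, e]⟩
  · rintro ⟨T, U, W, S, c, hT, hU, h0, hS, hc, hs, hd, e⟩ x hx
    exact hc.trans (SosDualFeasible.le_eval ⟨hS, hT, hU, h0, hs, hd, e⟩ hx)

end SosDuality
end

noncomputable section
namespace SosDuality
open MvPolynomial Matrix

/-! ### Gram matrices of quadratic sos-matrices -/

/-- If a sum of squares has degree at most `2 * d`, then all the terms that are squared have
degree at most `d`. -/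
lemma totalDegree_le_of_sum_sq {n d : ℕ} {ι : Type*} [Fintype ι]
    (p : ι → MvPolynomial (Fin n) ℝ) (h : (∑ k, p k * p k).totalDegree ≤ 2 * d) (k : ι) :
    (p k).totalDegree ≤ d := by
  -- Let μ be the largest leading monomial of the terms. The coefficient of the sum at μ + μ is a
  -- sum of squares, so leading terms cannot cancel. A graded order makes μ bound every total
  -- degree.
  let m : MonomialOrder (Fin n) := MonomialOrder.degLex
  obtain ⟨k₀, -, hk₀⟩ := Finset.exists_max_image Finset.univ (fun k => m.toSyn (m.degree (p k)))
    ⟨k, Finset.mem_univ k⟩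
  have hle : ∀ k, m.toSyn (m.degree (p k)) ≤ m.toSyn (m.degree (p k₀)) := fun k =>
    hk₀ k (Finset.mem_univ k)
  set μ := m.degree (p k₀) with hμ
  have hμd : μ.degree ≤ d := by
    by_cases h0 : p k₀ = 0
    · rw [hμ, h0, MonomialOrder.degree_zero, map_zero]
      exact Nat.zero_le d
    have hc : (∑ k, p k * p k).coeff (μ + μ) ≠ 0 := by
      rw [coeff_sum]
      refine ne_of_gt (Finset.sum_pos' (fun k _ => ?_) ⟨k₀, Finset.mem_univ _, ?_⟩)
      · rw [m.coeff_mul_of_add_of_degree_le (hle k) (hle k)]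
        exact mul_self_nonneg _
      · rw [m.coeff_mul_of_add_of_degree_le le_rfl le_rfl]
        exact mul_self_pos.2 (m.leadingCoeff_ne_zero_iff.2 h0)
    have := degree_le_of_coeff_ne_zero h hc
    rw [map_add] at this
    omega
  refine Finset.sup_le fun ν hν => ?_
  have hνμ : m.toSyn ν ≤ m.toSyn μ := (m.le_degree hν).trans (hle k)
  rw [MonomialOrder.degLex_le_iff, Finsupp.DegLex.le_iff] at hνμ
  have : ν.degree ≤ μ.degree := by
    rcases hνμ with h | h
    exacts [h.le, h.1.le]
  exact this.trans hμd

variable {n α : ℕ}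

/-- The matrix polynomial with a given Gram matrix, as a linear map. -/
def gram (n α : ℕ) :
    Matrix (Fin α × MonomialIndex n 1) (Fin α × MonomialIndex n 1) ℝ →ₗ[ℝ]
      Matrix (Fin α) (Fin α) (MvPolynomial (Fin n) ℝ) where
  toFun G := Matrix.of fun i j => ∑ p, ∑ q, monomial (p.1 + q.1) (G (i, p) (j, q))
  map_add' G G' := by
    ext1 i j
    simp [Finset.sum_add_distrib]
  map_smul' c G := by
    ext1 i j
    simp [Finset.smul_sum, smul_monomial]

lemma gram_apply (G : Matrix (Fin α × MonomialIndex n 1) (Fin α × MonomialIndex n 1) ℝ)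
    (i j : Fin α) : gram n α G i j = ∑ p, ∑ q, monomial (p.1 + q.1) (G (i, p) (j, q)) := rfl

lemma gram_transpose_mul {ι : Type*} [Fintype ι] (B : Matrix ι (Fin α × MonomialIndex n 1) ℝ) :
    gram n α (Bᵀ * B) = (Matrix.of fun k i => polyOfVec n 1 fun p => B k (i, p))ᵀ *
      (Matrix.of fun k i => polyOfVec n 1 fun p => B k (i, p)) := by
  refine Matrix.ext fun i j => ?_
  rw [gram_apply, Matrix.mul_apply]
  simp only [transpose_apply, of_apply, polyOfVec_apply, Finset.sum_mul_sum, monomial_mul,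
    Matrix.mul_apply, map_sum]
  calc _ = ∑ p, ∑ k, ∑ q : MonomialIndex n 1, monomial (p.1 + q.1) (B k (i, p) * B k (j, q)) :=
        Finset.sum_congr rfl fun p _ => Finset.sum_comm
    _ = _ := Finset.sum_comm

/-- The diagonal entries of P*P are sums of squares of degree at most two, so P has entries of
degree at most one. Its coefficients then form a factor of a Gram matrix. -/
lemma isQuadraticSosMatrix_iff {T : Matrix (Fin α) (Fin α) (MvPolynomial (Fin n) ℝ)} :
    IsQuadraticSosMatrix T ↔ ∃ G : Matrix (Fin α × MonomialIndex n 1) (Fin α × MonomialIndex n 1) ℝ,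
      G.PosSemidef ∧ gram n α G = T := by
  constructor
  · rintro ⟨⟨s, P, rfl⟩, hd⟩
    have hP : ∀ k i, (P k i).totalDegree ≤ 1 := fun k i =>
      totalDegree_le_of_sum_sq (fun k => P k i) (by simpa [Matrix.mul_apply] using hd i i) k
    let B : Matrix (Fin s) (Fin α × MonomialIndex n 1) ℝ := fun k ip => (P k ip.1).coeff ip.2.1
    refine ⟨Bᵀ * B, posSemidef_transpose_mul_self B, ?_⟩
    have : (Matrix.of fun k i => polyOfVec n 1 fun p => B k (i, p)) = P := by
      ext1 k i
      exact polyOfVec_coeffVec (hP k i)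
    rw [gram_transpose_mul, this]
  · rintro ⟨G, hG, rfl⟩
    obtain ⟨B, rfl⟩ := posSemidef_iff_exists_transpose_mul.1 hG
    rw [gram_transpose_mul]
    set P : Matrix (Fin α × MonomialIndex n 1) (Fin α) (MvPolynomial (Fin n) ℝ) :=
      Matrix.of fun k i => polyOfVec n 1 fun p => B k (i, p)
    let e := (Fintype.equivFin (Fin α × MonomialIndex n 1)).symm
    have : Pᵀ * P = (P.submatrix e id)ᵀ * P.submatrix e id := by
      rw [transpose_submatrix, submatrix_mul_equiv, submatrix_id_id]
    rw [this]
    exact isQuadraticSosMatrix_transpose_mul _ fun k i => totalDegree_polyOfVec_le _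

/-! ### Positive semidefinite block matrices -/

lemma posSemidef_fromBlocks_zero {I J : Type*} [Fintype I] [Fintype J] {P : Matrix I I ℝ}
    {Q : Matrix J J ℝ} : (fromBlocks P 0 0 Q).PosSemidef ↔ P.PosSemidef ∧ Q.PosSemidef := by
  constructor
  · exact fun h => ⟨h.submatrix Sum.inl, h.submatrix Sum.inr⟩
  · rintro ⟨hP, hQ⟩
    refine .of_dotProduct_mulVec_nonneg (.fromBlocks hP.1 (by simp) hQ.1) fun x => ?_
    have h1 := hP.dotProduct_mulVec_nonneg (x ∘ Sum.inl)
    have h2 := hQ.dotProduct_mulVec_nonneg (x ∘ Sum.inr)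
    rw [star_trivial] at *
    rw [fromBlocks_mulVec, zero_mulVec, zero_mulVec, add_zero, zero_add, dotProduct,
      Fintype.sum_sum_type]
    exact add_nonneg h1 h2

lemma posSemidef_blockDiagonal {I J : Type*} [Fintype I] [Fintype J] [DecidableEq J]
    {M : J → Matrix I I ℝ} : (blockDiagonal M).PosSemidef ↔ ∀ k, (M k).PosSemidef := by
  constructor
  · intro h k
    convert! h.submatrix (fun i => (i, k)) using 1
    ext i j
    simp
  · intro h
    refine .of_dotProduct_mulVec_nonneg (isHermitian_blockDiagonal_iff.2 fun k => (h k).1)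
      fun x => ?_
    rw [star_trivial, dotProduct, Fintype.sum_prod_type, Finset.sum_comm]
    refine Finset.sum_nonneg fun k _ => ?_
    have h1 := (h k).dotProduct_mulVec_nonneg fun i => x (i, k)
    rw [star_trivial] at h1
    refine h1.trans_eq (Finset.sum_congr rfl fun i _ => ?_)
    congr 1
    simp [mulVec, dotProduct, Fintype.sum_prod_type, blockDiagonal_apply]

/-! ### Affine forms -/

section affine

variable {K : Type*} [CommRing K] (φ : K →+* ℝ)

/-- The value at `y` of an affine form, given by its constant coefficient and the coefficients
of the variables. -/
def affEval {ι : Type*} [Fintype ι] (y : ι → ℝ) : (Option ι → K) →+ ℝ where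
  toFun c := φ (c none) + ∑ v, φ (c (some v)) * y v
  map_zero' := by simp
  map_add' c c' := by
    simp only [Pi.add_apply, map_add, add_mul, Finset.sum_add_distrib]
    ring

lemma affEval_apply {ι : Type*} [Fintype ι] (y : ι → ℝ) (c : Option ι → K) :
    affEval φ y c = φ (c none) + ∑ v, φ (c (some v)) * y v := rfl

@[simp] lemma affEval_single_some {ι : Type*} [Fintype ι] [DecidableEq ι] (y : ι → ℝ) (v : ι) :
    affEval φ y (Pi.single (some v) 1) = y v := by
  simp [affEval_apply, Pi.single_apply, apply_ite φ]

@[simp] lemma affEval_single_none {ι : Type*} [Fintype ι] [DecidableEq ι] (y : ι → ℝ) (c : K) :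
    affEval φ y (Pi.single none c) = φ c := by
  simp [affEval_apply]

/-- The linear polynomial with given coefficients. -/
def linPoly {m : ℕ} (c : Option (Fin m) → K) : MvPolynomial (Fin m) K :=
  C (c none) + ∑ i, C (c (some i)) * X i

lemma totalDegree_linPoly_le {m : ℕ} (c : Option (Fin m) → K) : (linPoly c).totalDegree ≤ 1 := by
  refine (totalDegree_add _ _).trans (max_le (by simp) (totalDegree_finsetSum_le fun i _ => ?_))
  refine (totalDegree_mul _ _).trans ?_
  rw [totalDegree_C, zero_add]
  exact (totalDegree_monomial_le _ _).trans (by simp)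

lemma coeff_zero_linPoly {m : ℕ} (c : Option (Fin m) → K) : (linPoly c).coeff 0 = c none := by
  simp [linPoly, coeff_sum, coeff_zero_X]

lemma coeff_single_linPoly {m : ℕ} (c : Option (Fin m) → K) (i : Fin m) :
    (linPoly c).coeff (Finsupp.single i 1) = c (some i) := by
  classical
  simp [linPoly, coeff_sum, coeff_C, coeff_C_mul, coeff_X, Finsupp.single_left_inj,
    eq_comm (a := (0 : Fin m →₀ ℕ))]

lemma eval_map_linPoly {m : ℕ} (c : Option (Fin m) → K) (y : Fin m → ℝ) :
    eval y (MvPolynomial.map φ (linPoly c)) = affEval φ y c := by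
  simp [linPoly, affEval_apply]

lemma totalDegree_map_le {m : ℕ} (f : MvPolynomial (Fin m) K) :
    (MvPolynomial.map φ f).totalDegree ≤ f.totalDegree :=
  Finset.sup_mono (support_map_subset φ f)

/-- A semidefinite program whose variables and whose rows are indexed by arbitrary finite types
can be written with indices in `Fin m` and `Fin β`. -/
lemma isSDPFormulation_of_affEval {A : Matrix (Fin α) (Fin α) (MvPolynomial (Fin n) ℝ)}
    {l : MvPolynomial (Fin n) ℝ} {ι J : Type*} [Fintype ι] [Fintype J]
    {b : Matrix J J (Option ι → K)} (hb : b.IsSymm) {g : Option ι → K}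
    (π : (ι → ℝ) →ₗ[ℝ] SosDualPoint n α)
    (hπ : π '' {y | (b.map (affEval φ y)).PosSemidef} = sosDualFeasibleSet A l)
    (hg : ∀ y, (π y).1 = affEval φ y g) :
    IsSDPFormulation A l
      ((Matrix.of fun i j : Fin (Fintype.card J) => linPoly fun o : Option (Fin (Fintype.card ι)) =>
        b ((Fintype.equivFin J).symm i) ((Fintype.equivFin J).symm j)
          (o.map (Fintype.equivFin ι).symm)).map (MvPolynomial.map φ))
      (MvPolynomial.map φ (linPoly fun o : Option (Fin (Fintype.card ι)) =>
        g (o.map (Fintype.equivFin ι).symm))) := by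
  set e := (Fintype.equivFin ι).symm
  set e' := (Fintype.equivFin J).symm
  have hev : ∀ (c : Option ι → K) (y : Fin (Fintype.card ι) → ℝ),
      affEval φ y (fun o => c (o.map e)) = affEval φ (y ∘ e.symm) c := by
    intro c y
    simp only [affEval_apply, Option.map_none, Option.map_some]
    congr 1
    exact Fintype.sum_equiv e _ _ fun i => by simp
  refine ⟨⟨?_, fun i j => ?_⟩, ?_, (π ∘ₗ LinearMap.funLeft ℝ ℝ e.symm).toAffineMap, ?_, fun y => ?_⟩
  · ext1 i j
    simp [hb.apply]
  · rw [map_apply, of_apply]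
    exact (totalDegree_map_le φ _).trans (totalDegree_linPoly_le _)
  · exact (totalDegree_map_le φ _).trans (totalDegree_linPoly_le _)
  · rw [← hπ]
    have hmem : ∀ y : Fin (Fintype.card ι) → ℝ, y ∈ spectrahedron
        ((Matrix.of fun i j : Fin (Fintype.card J) =>
          linPoly fun o : Option (Fin (Fintype.card ι)) => b (e' i) (e' j)
            (o.map e)).map (MvPolynomial.map φ)) ↔
        (b.map (affEval φ (y ∘ e.symm))).PosSemidef := by
      intro y
      rw [← posSemidef_submatrix_equiv e']
      refine Eq.to_iff (congrArg Matrix.PosSemidef ?_)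
      ext i j
      simp only [map_apply, of_apply, eval_map_linPoly, hev, submatrix_apply]
    ext z
    constructor
    · rintro ⟨y, hy, rfl⟩
      exact ⟨y ∘ e.symm, (hmem y).1 hy, rfl⟩
    · rintro ⟨y, hy, rfl⟩
      have : (y ∘ e) ∘ e.symm = y := by ext; simp
      refine ⟨y ∘ e, (hmem _).2 (by rwa [this]), ?_⟩
      change π ((y ∘ e) ∘ e.symm) = π y
      rw [this]
  · rw [eval_map_linPoly, hev, ← hg]
    rfl

end affine

end SosDuality
end

noncomputable section
namespace SosDuality
open MvPolynomial Matrix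

/-! ### The sums of squares dual as a semidefinite program -/

/-- The index type of the rows of the Gram matrices. -/
abbrev GramIndex (n α : ℕ) : Type := Fin α × MonomialIndex n 1

/-- The variables of the semidefinite program: the number `a` and the entries of `S`, of the Gram
matrices of the `Sᵢ`, of the `Uᵢ` and of the `Wᵢ` with `i ≥ 1`. -/
abbrev DualVar (n α : ℕ) : Type :=
  Unit ⊕ (Fin α × Fin α) ⊕ (Fin n × GramIndex n α × GramIndex n α) ⊕
    (Fin n × MonomialIndex n 1 × MonomialIndex n 1) ⊕
    (Fin n × MonomialIndex n 2 × MonomialIndex n 1)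

/-- The indices of the equality constraints. -/
abbrev DualEq (n α : ℕ) : Type :=
  -- Degree three suffices: W contributes 2 + 1 and the product of A with a quadratic sos-matrix 1 +
  -- 2.
  (Fin n × MonomialIndex n 3) ⊕ MonomialIndex n 3 ⊕ (Fin α × Fin α) ⊕
    (Fin n × GramIndex n α × GramIndex n α) ⊕ (Fin n × MonomialIndex n 1 × MonomialIndex n 1)

instance (n α : ℕ) : DecidableEq (DualVar n α) := Classical.decEq _

instance (n α : ℕ) : DecidableEq (DualEq n α) := Classical.decEq _

/-- The indices of the rows of the pencil. -/
abbrev DualRow (n α : ℕ) : Type :=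
  Fin α ⊕ (GramIndex n α × Fin n) ⊕ ((MonomialIndex n 2 ⊕ MonomialIndex n 1) × Fin n) ⊕
    DualEq n α ⊕ DualEq n α

variable {n α : ℕ}

/-- The variable `a`. -/
abbrev varA : DualVar n α := .inl ()
/-- The entries of `S`. -/
abbrev varS (i j : Fin α) : DualVar n α := .inr (.inl (i, j))
/-- The entries of the Gram matrices. -/
abbrev varG (k : Fin n) (a b : GramIndex n α) : DualVar n α := .inr (.inr (.inl (k, a, b)))
/-- The entries of the matrices `Uᵢ`. -/
abbrev varU (k : Fin n) (p q : MonomialIndex n 1) : DualVar n α :=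
  .inr (.inr (.inr (.inl (k, p, q))))
/-- The entries of the matrices `Wᵢ`. -/
abbrev varW (k : Fin n) (p : MonomialIndex n 2) (q : MonomialIndex n 1) : DualVar n α :=
  .inr (.inr (.inr (.inr (k, p, q))))

section values

variable (y : DualVar n α → ℝ)

/-- The matrix `S` at a point of the semidefinite program. -/
def valS : Matrix (Fin α) (Fin α) ℝ := .of fun i j => y (varS i j)
/-- The Gram matrices at a point of the semidefinite program. -/
def valG (k : Fin n) : Matrix (GramIndex n α) (GramIndex n α) ℝ := .of fun a b => y (varG k a b)
/-- The matrices `Uᵢ` at a point of the semidefinite program. -/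
def valU (k : Fin n) : Matrix (MonomialIndex n 1) (MonomialIndex n 1) ℝ :=
  .of fun p q => y (varU k p q)
/-- The matrices `W₁, …, Wₙ` at a point of the semidefinite program. -/
def valW (k : Fin n) : Matrix (MonomialIndex n 2) (MonomialIndex n 1) ℝ :=
  .of fun p q => y (varW k p q)
/-- The matrices `W₀ = 0, W₁, …, Wₙ` at a point of the semidefinite program. -/
def valW₀ : Fin (n + 1) → Matrix (MonomialIndex n 2) (MonomialIndex n 1) ℝ :=
  Fin.cases 0 (valW y)

@[simp] lemma valW₀_zero : valW₀ y 0 = 0 := rfl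
@[simp] lemma valW₀_succ (k : Fin n) : valW₀ y k.succ = valW y k := rfl

end values

/-- The map from the variables of the semidefinite program to the tuples of matrices. -/
def dualPoint (n α : ℕ) : (DualVar n α → ℝ) →ₗ[ℝ] SosDualPoint n α where
  toFun y := (y varA, valS y, fun k => gram n α (valG y k), valU y, valW₀ y)
  map_add' y z := by
    refine Prod.ext rfl (Prod.ext rfl (Prod.ext ?_ (Prod.ext rfl ?_)))
    · exact funext fun k => map_add (gram n α) (valG y k) (valG z k)
    · refine funext fun k => Fin.cases ?_ (fun k => rfl) k
      exact (add_zero _).symm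
  map_smul' c y := by
    refine Prod.ext rfl (Prod.ext rfl (Prod.ext ?_ (Prod.ext rfl ?_)))
    · exact funext fun k => map_smul (gram n α) c (valG y k)
    · refine funext fun k => Fin.cases ?_ (fun k => rfl) k
      exact (smul_zero c).symm

/-! ### Coefficients of the pencil, over a ring K standing for both ℚ and ℝ -/

section pencil

variable {K : Type*} [CommRing K] (A : Matrix (Fin α) (Fin α) (MvPolynomial (Fin n) K))
  (l : MvPolynomial (Fin n) K)

/-- The coefficient of `x ^ μ` in `xᵀ Uᵢ x + xᵀ Wᵢ₋₁ x + tr (A Sᵢ)`. -/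
def stepForm (i : Fin n) (μ : MonomialIndex n 3) : Option (DualVar n α) → K
  | none => 0
  | some (.inl _) => 0
  | some (.inr (.inl _)) => 0
  | some (.inr (.inr (.inl (k, a, b)))) =>
    if k = i then coeff μ.1 (A b.1 a.1 * monomial (a.2.1 + b.2.1) 1) else 0
  | some (.inr (.inr (.inr (.inl (k, p, q))))) => if k = i ∧ p.1 + q.1 = μ.1 then 1 else 0
  | some (.inr (.inr (.inr (.inr (k, p, q))))) =>
    if k.succ = i.castSucc ∧ p.1 + q.1 = μ.1 then 1 else 0

/-- The coefficient of `x ^ μ` in `ℓ - a + xᵀ Wₙ x - tr (A S)`. -/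
def finalForm (μ : MonomialIndex n 3) : Option (DualVar n α) → K
  | none => coeff μ.1 l
  | some (.inl _) => if μ.1 = 0 then -1 else 0
  | some (.inr (.inl (i, j))) => -coeff μ.1 (A j i)
  | some (.inr (.inr (.inl _))) => 0
  | some (.inr (.inr (.inr (.inl _)))) => 0
  | some (.inr (.inr (.inr (.inr (k, p, q))))) =>
    if k.succ = Fin.last n ∧ p.1 + q.1 = μ.1 then 1 else 0

/-- A variable, as an affine form. -/
def varForm (K : Type*) [CommRing K] (v : DualVar n α) : Option (DualVar n α) → K :=
  Pi.single (some v) 1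

/-- The left-hand sides of the equality constraints. -/
def eqForm : DualEq n α → Option (DualVar n α) → K
  | .inl (i, μ) => stepForm A i μ
  | .inr (.inl μ) => finalForm A l μ
  | .inr (.inr (.inl (i, j))) => varForm K (varS i j) - varForm K (varS j i)
  | .inr (.inr (.inr (.inl (k, a, b)))) => varForm K (varG k a b) - varForm K (varG k b a)
  | .inr (.inr (.inr (.inr (k, p, q)))) => varForm K (varU k p q) - varForm K (varU k q p)

/-- The block `2 [1, W; Wᵀ, U]` that expresses `U ⪰ Wᵀ W`. -/
def schurBlock (K : Type*) [CommRing K] (k : Fin n) :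
    Matrix (MonomialIndex n 2 ⊕ MonomialIndex n 1) (MonomialIndex n 2 ⊕ MonomialIndex n 1)
      (Option (DualVar n α) → K) :=
  -- The factor two matches the last block, where U + Uᵀ replaces U to keep the affine forms
  -- symmetric.
  fromBlocks (diagonal fun _ => Pi.single none 2)
    (.of fun p q => varForm K (varW k p q) + varForm K (varW k p q))
    (.of fun q p => varForm K (varW k p q) + varForm K (varW k p q))
    (.of fun p q => varForm K (varU k p q) + varForm K (varU k q p))

/-- The pencil of the semidefinite program, with its entries given by their coefficients. -/
def dualPencil : Matrix (DualRow n α) (DualRow n α) (Option (DualVar n α) → K) :=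
  -- The variables at (i, j) and (j, i) are independent, so a pencil needs symmetrized entries; the
  -- equations then force S, the Gram matrices and the Uᵢ to be symmetric. The last two blocks hold
  -- each equation as a pair of opposite inequalities.
  fromBlocks (.of fun i j => varForm K (varS i j) + varForm K (varS j i)) 0 0 <|
  fromBlocks (blockDiagonal fun k => .of fun a b =>
    varForm K (varG k a b) + varForm K (varG k b a)) 0 0 <|
  fromBlocks (blockDiagonal fun k => schurBlock K k) 0 0 <|
  fromBlocks (diagonal (eqForm A l)) 0 0 (diagonal fun e => -eqForm A l e)

lemma isSymm_fromBlocks_zero {I J R : Type*} [Zero R] {P : Matrix I I R} {Q : Matrix J J R}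
    (hP : P.IsSymm) (hQ : Q.IsSymm) : (fromBlocks P 0 0 Q).IsSymm :=
  hP.fromBlocks transpose_zero hQ

lemma isSymm_blockDiagonal {I J R : Type*} [Zero R] [DecidableEq J] {M : J → Matrix I I R}
    (hM : ∀ k, (M k).IsSymm) : (blockDiagonal M).IsSymm := by
  rw [IsSymm, blockDiagonal_transpose]
  exact congrArg _ (funext hM)

lemma isSymm_of_add_comm {I R : Type*} [AddCommSemigroup R] (f : I → I → R) :
    (Matrix.of fun i j => f i j + f j i).IsSymm :=
  Matrix.ext fun _ _ => add_comm _ _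

lemma isSymm_schurBlock (k : Fin n) : (schurBlock (α := α) K k).IsSymm := by
  rw [schurBlock]
  exact (isSymm_diagonal _).fromBlocks (Matrix.ext fun _ _ => rfl) (isSymm_of_add_comm _)

lemma isSymm_dualPencil : (dualPencil A l).IsSymm := by
  rw [dualPencil]
  refine isSymm_fromBlocks_zero (isSymm_of_add_comm _) <| isSymm_fromBlocks_zero
    (isSymm_blockDiagonal fun k => isSymm_of_add_comm _) <| isSymm_fromBlocks_zero
    (isSymm_blockDiagonal fun k => isSymm_schurBlock k) <| isSymm_fromBlocks_zero
    (isSymm_diagonal _) (isSymm_diagonal _)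

/-- All coefficients of the pencil are small integers or, up to sign, coefficients of the data. -/
lemma dualPencil_induction {Q : K → Prop} (h0 : Q 0) (h1 : Q 1) (h1' : Q (-1)) (h2 : Q 2)
    (hA : ∀ i j μ, Q (coeff μ (A i j))) (hA' : ∀ i j μ, Q (-coeff μ (A i j)))
    (hl : ∀ μ, Q (coeff μ l)) (hl' : ∀ μ, Q (-coeff μ l)) (i j : DualRow n α)
    (o : Option (DualVar n α)) : Q (dualPencil A l i j o) := by
  have hvar : ∀ v w : DualVar n α, Q ((varForm K v + varForm K w) o) := fun v w => by
    simp only [varForm, Pi.add_apply, Pi.single_apply]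
    split_ifs <;> simpa [one_add_one_eq_two]
  have hvar' : ∀ v w : DualVar n α, Q ((varForm K v - varForm K w) o) ∧
      Q (-(varForm K v - varForm K w) o) := fun v w => by
    simp only [varForm, Pi.sub_apply, Pi.single_apply]
    split_ifs <;> simp [*]
  have hmul : ∀ i j μ ν, Q (coeff μ (A i j * monomial ν 1)) ∧
      Q (-coeff μ (A i j * monomial ν 1)) := fun i j μ ν => by
    rw [coeff_mul_monomial']
    split_ifs <;> simp [*]
  have heq : ∀ e : DualEq n α, Q (eqForm A l e o) ∧ Q (-eqForm A l e o) := by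
    rintro (⟨i, μ⟩ | μ | ⟨i, j⟩ | ⟨k, a, b⟩ | ⟨k, p, q⟩)
    · rcases o with _ | _ | _ | ⟨k, a, b⟩ | ⟨k, p, q⟩ | ⟨k, p, q⟩ <;>
        simp only [eqForm, stepForm] <;> (try split_ifs) <;> simp [*]
    · rcases o with _ | _ | _ | ⟨k, a, b⟩ | ⟨k, p, q⟩ | ⟨k, p, q⟩ <;>
        simp only [eqForm, finalForm] <;> (try split_ifs) <;> simp [*]
    · exact hvar' _ _
    · exact hvar' _ _
    · exact hvar' _ _
  rcases i with i | ⟨a, k⟩ | ⟨p | p, k⟩ | e | e <;>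
    rcases j with j | ⟨b, k'⟩ | ⟨q | q, k'⟩ | e' | e' <;>
    simp only [dualPencil, fromBlocks_apply₁₁, fromBlocks_apply₁₂, fromBlocks_apply₂₁,
      fromBlocks_apply₂₂, Matrix.zero_apply, Pi.zero_apply, h0, of_apply, hvar,
      blockDiagonal_apply, diagonal_apply, schurBlock] <;>
    split_ifs <;>
    first
      | exact h0
      | exact hvar _ _
      | exact (heq _).1
      | exact (heq _).2
      | (rw [Pi.single_apply]; split_ifs <;> assumption)

end pencil
end SosDuality
end

/-! ### Agreement of the pencil with the constraints of the dual -/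

noncomputable section
namespace SosDuality
open MvPolynomial Matrix

variable {n α : ℕ}

lemma coeff_polyOfMatrix {e d : ℕ} (W : Matrix (MonomialIndex n e) (MonomialIndex n d) ℝ)
    (μ : Fin n →₀ ℕ) :
    coeff μ (polyOfMatrix W) = ∑ p, ∑ q, if p.1 + q.1 = μ then W p q else 0 := by
  classical
  simp [polyOfMatrix_eq_sum, coeff_sum, coeff_monomial]

lemma totalDegree_polyOfMatrix_le {e d : ℕ}
    (W : Matrix (MonomialIndex n e) (MonomialIndex n d) ℝ) :
    (polyOfMatrix W).totalDegree ≤ e + d := by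
  rw [polyOfMatrix_eq_sum]
  refine totalDegree_finsetSum_le fun p _ => totalDegree_finsetSum_le fun q _ =>
    (totalDegree_monomial_le _ _).trans ?_
  exact (map_add Finsupp.degree p.1 q.1).trans_le (add_le_add p.2 q.2)

lemma coeff_trace_mul_gram (A : Matrix (Fin α) (Fin α) (MvPolynomial (Fin n) ℝ))
    (G : Matrix (GramIndex n α) (GramIndex n α) ℝ) (μ : Fin n →₀ ℕ) :
    coeff μ (A * gram n α G).trace
      = ∑ a, ∑ b, coeff μ (A b.1 a.1 * monomial (a.2.1 + b.2.1) 1) * G a b := by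
  have hm : ∀ (f : MvPolynomial (Fin n) ℝ) (ν : Fin n →₀ ℕ) (c : ℝ),
      coeff μ (f * monomial ν c) = coeff μ (f * monomial ν 1) * c := by
    intro f ν c
    rw [coeff_mul_monomial', coeff_mul_monomial']
    split_ifs <;> simp
  simp only [Fintype.sum_prod_type, Matrix.trace, diag_apply, Matrix.mul_apply, gram_apply,
    Finset.mul_sum, coeff_sum]
  rw [Finset.sum_comm]
  refine Finset.sum_congr rfl fun s _ => ?_
  rw [Finset.sum_comm]
  calc _ = ∑ p : MonomialIndex n 1, ∑ t, ∑ q : MonomialIndex n 1,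
        coeff μ (A t s * monomial (p.1 + q.1) (G (s, p) (t, q))) := rfl
    _ = _ := Finset.sum_congr rfl fun p _ => Finset.sum_congr rfl fun t _ =>
        Finset.sum_congr rfl fun q _ => hm _ _ _

lemma totalDegree_gram_le (G : Matrix (GramIndex n α) (GramIndex n α) ℝ) (i j : Fin α) :
    (gram n α G i j).totalDegree ≤ 2 :=
  totalDegree_polyOfMatrix_le (Matrix.of fun p q => G (i, p) (j, q)) |> fun h => by
    rwa [polyOfMatrix_eq_sum] at h

lemma totalDegree_trace_mul_le {A T : Matrix (Fin α) (Fin α) (MvPolynomial (Fin n) ℝ)} {d e : ℕ}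
    (hA : ∀ i j, (A i j).totalDegree ≤ d) (hT : ∀ i j, (T i j).totalDegree ≤ e) :
    (A * T).trace.totalDegree ≤ d + e := by
  refine totalDegree_finsetSum_le fun i _ => ?_
  rw [diag_apply, Matrix.mul_apply]
  exact totalDegree_finsetSum_le fun j _ =>
    (totalDegree_mul _ _).trans (add_le_add (hA i j) (hT j i))

lemma eq_zero_iff_coeff {d : ℕ} {f : MvPolynomial (Fin n) ℝ} (hf : f.totalDegree ≤ d) :
    f = 0 ↔ ∀ μ : MonomialIndex n d, coeff μ.1 f = 0 := by
  constructor
  · rintro rfl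
    simp
  · intro h
    ext μ
    by_contra hμ
    exact hμ (h ⟨μ, degree_le_of_coeff_ne_zero hf hμ⟩)

section evaluation

variable {K : Type*} [CommRing K] (φ : K →+* ℝ) (A : Matrix (Fin α) (Fin α) (MvPolynomial (Fin n) K))
  (l : MvPolynomial (Fin n) K) (y : DualVar n α → ℝ)

@[simp] lemma affEval_varForm (v : DualVar n α) : affEval φ y (varForm K v) = y v :=
  affEval_single_some φ y v

/-- There are no variables for W₀: for j = 0 no index satisfies `k.succ = j`, and both sides vanish.
-/
lemma sum_valW₀ (j : Fin (n + 1)) (μ : Fin n →₀ ℕ) :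
    ∑ k : Fin n, ∑ p, ∑ q, φ (if k.succ = j ∧ p.1 + q.1 = μ then 1 else 0) * y (varW k p q)
      = coeff μ (polyOfMatrix (valW₀ y j)) := by
  rw [coeff_polyOfMatrix]
  refine Fin.cases ?_ (fun i => ?_) j
  · simp [Fin.succ_ne_zero]
  · rw [Finset.sum_eq_single i]
    · simp [apply_ite φ, valW]
    · intro k _ hk
      simp [hk]
    · simp

lemma affEval_stepForm (i : Fin n) (μ : MonomialIndex n 3) :
    affEval φ y (stepForm A i μ) = coeff μ.1 (polyOfMatrix (valU y i) +
      polyOfMatrix (valW₀ y i.castSucc) +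
      (A.map (MvPolynomial.map φ) * gram n α (valG y i)).trace) := by
  have hG : ∑ k : Fin n, ∑ a : GramIndex n α, ∑ b : GramIndex n α,
      φ (if k = i then coeff μ.1 (A b.1 a.1 * monomial (a.2.1 + b.2.1) 1) else 0) * y (varG k a b)
      = coeff μ.1 (A.map (MvPolynomial.map φ) * gram n α (valG y i)).trace := by
    rw [coeff_trace_mul_gram, Finset.sum_eq_single i]
    · refine Finset.sum_congr rfl fun a _ => Finset.sum_congr rfl fun b _ => ?_
      rw [if_pos rfl, ← coeff_map, map_mul, map_monomial, map_one]
      rfl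
    · intro k _ hk
      simp [hk]
    · simp
  have hU : ∑ k : Fin n, ∑ p, ∑ q,
      φ (if k = i ∧ p.1 + q.1 = μ.1 then 1 else 0) * y (varU k p q)
      = coeff μ.1 (polyOfMatrix (valU y i)) := by
    rw [coeff_polyOfMatrix, Finset.sum_eq_single i]
    · simp [apply_ite φ, valU]
    · intro k _ hk
      simp [hk]
    · simp
  rw [coeff_add, coeff_add, ← hG, ← hU, ← sum_valW₀ φ, affEval_apply, Fintype.sum_sum_type,
    Fintype.sum_sum_type, Fintype.sum_sum_type, Fintype.sum_sum_type]
  simp only [Fintype.sum_prod_type (f := fun x : Fin n × GramIndex n α × GramIndex n α => _),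
    Fintype.sum_prod_type (f := fun x : GramIndex n α × GramIndex n α => _),
    Fintype.sum_prod_type (f := fun x : Fin n × MonomialIndex n 1 × MonomialIndex n 1 => _),
    Fintype.sum_prod_type (f := fun x : MonomialIndex n 1 × MonomialIndex n 1 => _),
    Fintype.sum_prod_type (f := fun x : Fin n × MonomialIndex n 2 × MonomialIndex n 1 => _),
    Fintype.sum_prod_type (f := fun x : MonomialIndex n 2 × MonomialIndex n 1 => _),
    stepForm, map_zero, zero_mul, Finset.sum_const_zero, zero_add]
  ring

lemma affEval_finalForm (μ : MonomialIndex n 3) :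
    affEval φ y (finalForm A l μ) = coeff μ.1 (MvPolynomial.map φ l - C (y varA) +
      polyOfMatrix (valW₀ y (Fin.last n)) -
      (A.map (MvPolynomial.map φ) * (valS y).map C).trace) := by
  have hS : ∑ i : Fin α, ∑ j : Fin α, φ (-coeff μ.1 (A j i)) * y (varS i j)
      = -coeff μ.1 (A.map (MvPolynomial.map φ) * (valS y).map C).trace := by
    simp only [Matrix.trace, diag_apply, Matrix.mul_apply, coeff_sum, map_apply,
      mul_comm _ (C _), coeff_C_mul, coeff_map, map_neg, neg_mul, Finset.sum_neg_distrib]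
    rw [Finset.sum_comm]
    simp only [mul_comm, valS, of_apply]
  rw [coeff_sub, coeff_add, coeff_sub, sub_eq_add_neg _ (coeff μ.1 (Matrix.trace _)), ← hS,
    ← sum_valW₀ φ, affEval_apply, Fintype.sum_sum_type,
    Fintype.sum_sum_type, Fintype.sum_sum_type, Fintype.sum_sum_type]
  simp only [Fintype.sum_prod_type (f := fun x : Fin α × Fin α => _),
    Fintype.sum_prod_type (f := fun x : Fin n × MonomialIndex n 2 × MonomialIndex n 1 => _),
    Fintype.sum_prod_type (f := fun x : MonomialIndex n 2 × MonomialIndex n 1 => _),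
    finalForm, map_zero, zero_mul, Finset.sum_const_zero, zero_add, coeff_map,
    Finset.univ_unique, Finset.sum_singleton, coeff_C]
  have : φ (if μ.1 = 0 then -1 else 0) * y (.inl default) = -(if 0 = μ.1 then y varA else 0) := by
    by_cases h : μ.1 = 0
    · simp [h]
    · simp [h, eq_comm (a := (0 : Fin n →₀ ℕ))]
  rw [this]
  ring

/-- The conditions on `y` that the pencil expresses. -/
lemma posSemidef_dualPencil_iff : ((dualPencil A l).map (affEval φ y)).PosSemidef ↔
    (valS y + (valS y)ᵀ).PosSemidef ∧ (∀ k, (valG y k + (valG y k)ᵀ).PosSemidef) ∧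
    (∀ k, (fromBlocks ((2 : ℝ) • 1) ((2 : ℝ) • valW y k) ((2 : ℝ) • (valW y k)ᵀ)
      (valU y k + (valU y k)ᵀ)).PosSemidef) ∧ ∀ e, affEval φ y (eqForm A l e) = 0 := by
  have h0 : affEval φ y 0 = 0 := map_zero _
  have hS : (Matrix.of fun i j => varForm K (varS (n := n) (α := α) i j) +
      varForm K (varS j i)).map (affEval φ y) = valS y + (valS y)ᵀ := by
    ext i j
    simp [valS]
  have hG : ∀ k : Fin n, (Matrix.of fun a b => varForm K (varG (α := α) k a b) +
      varForm K (varG k b a)).map (affEval φ y) = valG y k + (valG y k)ᵀ := fun k => by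
    ext i j
    simp [valG]
  have hB : ∀ k : Fin n, (schurBlock (α := α) K k).map (affEval φ y) =
      fromBlocks ((2 : ℝ) • 1) ((2 : ℝ) • valW y k) ((2 : ℝ) • (valW y k)ᵀ)
        (valU y k + (valU y k)ᵀ) := fun k => by
    rw [schurBlock, fromBlocks_map]
    congr 1
    · rw [diagonal_map h0, smul_one_eq_diagonal]
      refine congrArg diagonal (funext fun _ => ?_)
      rw [affEval_single_none, map_ofNat]
    · ext p q
      simp [valW, two_mul]
    · ext p q
      simp [valW, two_mul]
    · ext p q
      simp [valU]
  rw [dualPencil, fromBlocks_map, fromBlocks_map, fromBlocks_map, fromBlocks_map]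
  simp only [Matrix.map_zero _ h0]
  rw [posSemidef_fromBlocks_zero, posSemidef_fromBlocks_zero, posSemidef_fromBlocks_zero,
    posSemidef_fromBlocks_zero, blockDiagonal_map _ _ h0, blockDiagonal_map _ _ h0,
    posSemidef_blockDiagonal, posSemidef_blockDiagonal, diagonal_map h0, diagonal_map h0,
    posSemidef_diagonal_iff, posSemidef_diagonal_iff, hS]
  simp only [hG, hB]
  refine and_congr_right fun _ => and_congr_right fun _ => and_congr_right fun _ => ?_
  rw [← forall_and]
  refine forall_congr' fun e => ?_
  rw [map_neg, neg_nonneg, and_comm]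
  exact le_antisymm_iff.symm

lemma posSemidef_add_transpose_iff {I : Type*} [Finite I] {M : Matrix I I ℝ} (hM : M.IsSymm) :
    (M + Mᵀ).PosSemidef ↔ M.PosSemidef := by
  rw [hM.eq]
  refine ⟨fun h => ?_, fun h => h.add h⟩
  have := h.smul (show (0 : ℝ) ≤ 1 / 2 by norm_num)
  rwa [← two_smul ℝ M, smul_smul, show (1 / 2 : ℝ) * 2 = 1 by norm_num, one_smul] at this

/-- For symmetric U the block matrix is twice [1, W; Wᵀ, U], whose Schur complement with respect to
the identity block is U - WᵀW. -/
lemma posSemidef_schur_iff {I J : Type*} [Fintype I] [DecidableEq I] [Finite J]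
    {U : Matrix J J ℝ} (hU : U.IsSymm) (W : Matrix I J ℝ) :
    (fromBlocks ((2 : ℝ) • (1 : Matrix I I ℝ)) ((2 : ℝ) • W) ((2 : ℝ) • Wᵀ) (U + Uᵀ)).PosSemidef ↔
      (U - Wᵀ * W).PosSemidef := by
  have h1 : fromBlocks ((2 : ℝ) • (1 : Matrix I I ℝ)) ((2 : ℝ) • W) ((2 : ℝ) • Wᵀ) (U + Uᵀ)
      = fromBlocks 1 W Wᴴ U + (fromBlocks 1 W Wᴴ U)ᵀ := by
    rw [fromBlocks_transpose, fromBlocks_add, conjTranspose_eq_transpose_of_trivial,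
      transpose_transpose, transpose_one, two_smul, two_smul, two_smul]
  have h2 : (fromBlocks 1 W Wᴴ U).IsSymm := by
    rw [conjTranspose_eq_transpose_of_trivial]
    exact isSymm_one.fromBlocks rfl hU
  have := (PosDef.one (n := I) (R := ℝ)).isUnit.invertible
  rw [h1, posSemidef_add_transpose_iff h2, PosDef.fromBlocks₁₁ W U PosDef.one, inv_one,
    Matrix.mul_one, conjTranspose_eq_transpose_of_trivial]

lemma eqForm_iff : (∀ e, affEval φ y (eqForm A l e) = 0) ↔
    (∀ i μ, affEval φ y (stepForm A i μ) = 0) ∧ (∀ μ, affEval φ y (finalForm A l μ) = 0) ∧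
    (valS y).IsSymm ∧ (∀ k, (valG y k).IsSymm) ∧ ∀ k, (valU y k).IsSymm := by
  constructor
  · refine fun h => ⟨fun i μ => h (.inl (i, μ)), fun μ => h (.inr (.inl μ)),
      .ext fun i j => ?_, fun k => .ext fun a b => ?_, fun k => .ext fun p q => ?_⟩
    · have := h (.inr (.inr (.inl (j, i))))
      simpa [eqForm, sub_eq_zero, valS] using this
    · have := h (.inr (.inr (.inr (.inl (k, b, a)))))
      simpa [eqForm, sub_eq_zero, valG] using this
    · have := h (.inr (.inr (.inr (.inr (k, q, p)))))
      simpa [eqForm, sub_eq_zero, valU] using this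
  · rintro ⟨h1, h2, h3, h4, h5⟩ (⟨i, μ⟩ | μ | ⟨i, j⟩ | ⟨k, a, b⟩ | ⟨k, p, q⟩)
    · exact h1 i μ
    · exact h2 μ
    · simpa [eqForm, sub_eq_zero, valS] using h3.apply j i
    · simpa [eqForm, sub_eq_zero, valG] using (h4 k).apply b a
    · simpa [eqForm, sub_eq_zero, valU] using (h5 k).apply q p

variable {A l}

/-- Positivity of the Gram matrices is a separate clause, because a sos-matrix also has Gram
matrices that are not positive semidefinite in general. -/
lemma posSemidef_dualPencil_iff_feasible (hA : IsLinearPencil A) (hl : IsLinearPoly l) :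
    ((dualPencil A l).map (affEval φ y)).PosSemidef ↔
      (∀ k, (valG y k).PosSemidef) ∧
      dualPoint n α y ∈ sosDualFeasibleSet (A.map (MvPolynomial.map φ)) (MvPolynomial.map φ l) := by
  have hAd : ∀ i j, (A.map (MvPolynomial.map φ) i j).totalDegree ≤ 1 := fun i j =>
    (totalDegree_map_le φ _).trans (hA.2 i j)
  have hstep : ∀ i : Fin n, (polyOfMatrix (valU y i) + polyOfMatrix (valW₀ y i.castSucc) +
      (A.map (MvPolynomial.map φ) * gram n α (valG y i)).trace = 0 ↔
      ∀ μ, affEval φ y (stepForm A i μ) = 0) := fun i => by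
    simp only [affEval_stepForm]
    refine eq_zero_iff_coeff ?_
    refine (totalDegree_add _ _).trans (max_le ((totalDegree_add _ _).trans (max_le ?_ ?_)) ?_)
    · exact (totalDegree_polyOfMatrix_le _).trans (by norm_num)
    · exact totalDegree_polyOfMatrix_le _
    · exact totalDegree_trace_mul_le hAd (totalDegree_gram_le _)
  have hfinal : MvPolynomial.map φ l - C (y varA) + polyOfMatrix (valW₀ y (Fin.last n)) -
      (A.map (MvPolynomial.map φ) * (valS y).map C).trace = 0 ↔
      ∀ μ, affEval φ y (finalForm A l μ) = 0 := by
    simp only [affEval_finalForm]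
    refine eq_zero_iff_coeff ?_
    refine (totalDegree_sub _ _).trans (max_le ((totalDegree_add _ _).trans (max_le ?_ ?_)) ?_)
    · refine (totalDegree_sub_C_le _ _).trans ((totalDegree_map_le φ l).trans (le_trans hl ?_))
      norm_num
    · exact totalDegree_polyOfMatrix_le _
    · refine (totalDegree_trace_mul_le (e := 0) hAd fun i j => ?_).trans (by norm_num)
      simp
  rw [posSemidef_dualPencil_iff, eqForm_iff]
  constructor
  · rintro ⟨hS, hG, hW, h1, h2, hS', hG', hU⟩
    have hGp : ∀ k, (valG y k).PosSemidef := fun k => (posSemidef_add_transpose_iff (hG' k)).1 (hG k)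
    exact ⟨hGp, (posSemidef_add_transpose_iff hS').1 hS,
      fun k => isQuadraticSosMatrix_iff.2 ⟨_, hGp k, rfl⟩, hU, rfl, fun i => (hstep i).2 (h1 i),
      fun k => (posSemidef_schur_iff (hU k) _).1 (hW k), hfinal.2 h2⟩
  · rintro ⟨hG, hS, hT, hU, hW0, h1, h2, h3⟩
    refine ⟨(posSemidef_add_transpose_iff hS.1).2 hS,
      fun k => (posSemidef_add_transpose_iff (hG k).1).2 (hG k),
      fun k => (posSemidef_schur_iff (hU k) _).2 (h2 k), fun i => (hstep i).1 (h1 i), hfinal.1 h3,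
      hS.1, fun k => (hG k).1, hU⟩

/-- Gram matrices are not unique, so a preimage is built by choosing a positive semidefinite one for
each Sᵢ. -/
lemma image_dualPoint (hA : IsLinearPencil A) (hl : IsLinearPoly l) :
    dualPoint n α '' {y | ((dualPencil A l).map (affEval φ y)).PosSemidef} =
      sosDualFeasibleSet (A.map (MvPolynomial.map φ)) (MvPolynomial.map φ l) := by
  ext z
  constructor
  · rintro ⟨y, hy, rfl⟩
    exact ((posSemidef_dualPencil_iff_feasible φ y hA hl).1 hy).2
  · intro hz
    obtain ⟨a, S, T, U, W⟩ := z
    choose G hG hGT using fun i => isQuadraticSosMatrix_iff.1 (hz.sos i)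
    let y : DualVar n α → ℝ
      | .inl _ => a
      | .inr (.inl (i, j)) => S i j
      | .inr (.inr (.inl (k, b, c))) => G k b c
      | .inr (.inr (.inr (.inl (k, p, q)))) => U k p q
      | .inr (.inr (.inr (.inr (k, p, q)))) => W k.succ p q
    have hy : dualPoint n α y = (a, S, T, U, W) := by
      refine Prod.ext rfl (Prod.ext rfl (Prod.ext (funext hGT) (Prod.ext rfl ?_)))
      refine funext fun k => Fin.cases ?_ (fun k => rfl) k
      exact hz.zero.symm
    refine ⟨y, (posSemidef_dualPencil_iff_feasible φ y hA hl).2 ⟨hG, ?_⟩, hy⟩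
    rwa [hy]

end evaluation
end SosDuality
end

noncomputable section
namespace SosDuality
open MvPolynomial Matrix

/-! ### Size bounds -/

lemma card_monomialIndex_le_of_le {n z : ℕ} (h : n + 1 ≤ z) (d : ℕ) :
    Fintype.card (MonomialIndex n d) ≤ z ^ d :=
  (card_monomialIndex_le n d).trans (Nat.pow_le_pow_left h d)

/-- There are five families of variables; the largest, the Gram entries, number at most z · (z ·
z)². -/
lemma card_dualVar_le {n α z : ℕ} (h : n + α + 1 ≤ z) :
    Fintype.card (DualVar n α) ≤ 5 * z ^ 5 := by
  have h1 := card_monomialIndex_le_of_le (n := n) (z := z) (by omega) 1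
  have h2 := card_monomialIndex_le_of_le (n := n) (z := z) (by omega) 2
  have hn : n ≤ z := by omega
  have ha : α ≤ z := by omega
  have hz : 1 ≤ z := by omega
  simp only [Fintype.card_sum, Fintype.card_prod, Fintype.card_fin, Fintype.card_unit]
  rw [pow_one] at h1
  calc _ ≤ 1 + (z * z + (z * (z * z * (z * z)) + (z * (z * z) + z * (z ^ 2 * z)))) := by gcongr
    _ = z ^ 0 + z ^ 2 + z ^ 5 + z ^ 3 + z ^ 4 := by ring
    _ ≤ z ^ 5 + z ^ 5 + z ^ 5 + z ^ 5 + z ^ 5 := by gcongr <;> omega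
    _ = _ := by ring

/-- Each of the five families of equations occupies two sets of rows, which gives 10; the other 4
come from S, the Gram blocks and the two parts of the Schur blocks. -/
lemma card_dualRow_le {n α z : ℕ} (h : n + α + 1 ≤ z) :
    Fintype.card (DualRow n α) ≤ 14 * z ^ 5 := by
  have h1 := card_monomialIndex_le_of_le (n := n) (z := z) (by omega) 1
  have h2 := card_monomialIndex_le_of_le (n := n) (z := z) (by omega) 2
  have h3 := card_monomialIndex_le_of_le (n := n) (z := z) (by omega) 3
  have hn : n ≤ z := by omega
  have ha : α ≤ z := by omega
  have hz : 1 ≤ z := by omega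
  have hE : Fintype.card (DualEq n α) ≤ 5 * z ^ 5 := by
    simp only [Fintype.card_sum, Fintype.card_prod, Fintype.card_fin]
    rw [pow_one] at h1
    calc _ ≤ z * z ^ 3 + (z ^ 3 + (z * z + (z * (z * z * (z * z)) + z * (z * z)))) := by gcongr
      _ = z ^ 4 + z ^ 3 + z ^ 2 + z ^ 5 + z ^ 3 := by ring
      _ ≤ z ^ 5 + z ^ 5 + z ^ 5 + z ^ 5 + z ^ 5 := by gcongr <;> omega
      _ = _ := by ring
  have hR : Fintype.card (DualRow n α) = α + (α * Fintype.card (MonomialIndex n 1) * n +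
      ((Fintype.card (MonomialIndex n 2) + Fintype.card (MonomialIndex n 1)) * n +
        (Fintype.card (DualEq n α) + Fintype.card (DualEq n α)))) := by
    simp only [Fintype.card_sum, Fintype.card_prod, Fintype.card_fin]
  rw [hR]
  rw [pow_one] at h1
  calc _ ≤ z + (z * z * z + ((z ^ 2 + z) * z + (5 * z ^ 5 + 5 * z ^ 5))) := by gcongr
    _ = z ^ 1 + z ^ 3 + z ^ 3 + z ^ 2 + 10 * z ^ 5 := by ring
    _ ≤ z ^ 5 + z ^ 5 + z ^ 5 + z ^ 5 + 10 * z ^ 5 := by gcongr <;> omega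
    _ = _ := by ring

lemma ratBits_neg (q : ℚ) : ratBits (-q) = ratBits q := by simp [ratBits]

lemma two_le_ratBits (q : ℚ) : 2 ≤ ratBits q := by
  have : 0 < q.den.size := Nat.size_pos.2 q.den_pos
  simp only [ratBits]
  omega

lemma ratBits_coeff_le {n : ℕ} {f : MvPolynomial (Fin n) ℚ} (hf : IsLinearPoly f)
    (μ : Fin n →₀ ℕ) : ratBits (coeff μ f) ≤ linearBits f := by
  by_cases h : coeff μ f = 0
  · have h2 : ratBits (coeff μ f) = 2 := by simp [h, ratBits]
    rw [h2]
    exact (two_le_ratBits _).trans (Nat.le_add_right _ _)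
  · rcases eq_zero_or_eq_single_of_degree_le_one (degree_le_of_coeff_ne_zero hf h) with rfl | ⟨i, rfl⟩
    · exact Nat.le_add_right _ _
    · exact (Finset.single_le_sum (f := fun i => ratBits (f.coeff (Finsupp.single i 1)))
        (fun _ _ => Nat.zero_le _) (Finset.mem_univ i)).trans (Nat.le_add_left _ _)

lemma succ_le_linearBits {n : ℕ} (f : MvPolynomial (Fin n) ℚ) : n + 1 ≤ linearBits f := by
  have h1 := two_le_ratBits (f.coeff 0)
  have h2 : n ≤ ∑ i, ratBits (f.coeff (Finsupp.single i 1)) := by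
    have := Finset.card_nsmul_le_sum Finset.univ
      (fun i => ratBits (f.coeff (Finsupp.single i 1))) 1
      fun i _ => one_le_two.trans (two_le_ratBits _)
    simpa using this
  simp only [linearBits]
  omega

lemma linearBits_le_sdpBits {n α : ℕ} (A : Matrix (Fin α) (Fin α) (MvPolynomial (Fin n) ℚ))
    (l : MvPolynomial (Fin n) ℚ) (i j : Fin α) : linearBits (A i j) ≤ sdpBits A l :=
  (Finset.single_le_sum (f := fun j => linearBits (A i j)) (fun _ _ => Nat.zero_le _)
    (Finset.mem_univ j)).trans <|
  (Finset.single_le_sum (f := fun i => ∑ j, linearBits (A i j)) (fun _ _ => Nat.zero_le _)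
    (Finset.mem_univ i)).trans (Nat.le_add_left _ _)

/-- Even a zero coefficient costs bits, so bounds in n + α become bounds in the bit size. -/
lemma add_succ_le_sdpBits {n α : ℕ} (A : Matrix (Fin α) (Fin α) (MvPolynomial (Fin n) ℚ))
    (l : MvPolynomial (Fin n) ℚ) : n + α + 1 ≤ sdpBits A l := by
  have h1 := succ_le_linearBits l
  have h2 : α ≤ ∑ i, ∑ j, linearBits (A i j) := by
    have := Finset.card_nsmul_le_sum Finset.univ (fun i => ∑ j, linearBits (A i j)) 1
      fun i _ => (Nat.succ_le_of_lt (Nat.succ_pos n)).trans <| (succ_le_linearBits (A i i)).trans <|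
        Finset.single_le_sum (f := fun j => linearBits (A i j)) (fun _ _ => Nat.zero_le _)
          (Finset.mem_univ i)
    simpa using this
  simp only [sdpBits]
  omega

lemma linearBits_linPoly_le {m R : ℕ} {c : Option (Fin m) → ℚ} (h : ∀ o, ratBits (c o) ≤ R) :
    linearBits (linPoly c) ≤ (m + 1) * R := by
  simp only [linearBits, coeff_zero_linPoly, coeff_single_linPoly]
  have := Finset.sum_le_card_nsmul Finset.univ (fun i => ratBits (c (some i))) R fun i _ => h _
  rw [Finset.card_univ, Fintype.card_fin, smul_eq_mul] at this
  have h0 := h none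
  linarith

lemma sdpBits_le {m β R : ℕ} {B : Matrix (Fin β) (Fin β) (MvPolynomial (Fin m) ℚ)}
    {g : MvPolynomial (Fin m) ℚ} (hB : ∀ i j, linearBits (B i j) ≤ R) (hg : linearBits g ≤ R) :
    sdpBits B g ≤ (1 + β * β) * R := by
  have h1 : ∀ i, ∑ j, linearBits (B i j) ≤ β * R := fun i => by
    simpa using Finset.sum_le_card_nsmul Finset.univ (fun j => linearBits (B i j)) R
      fun j _ => hB i j
  have h2 : ∑ i, ∑ j, linearBits (B i j) ≤ β * (β * R) := by
    simpa using Finset.sum_le_card_nsmul Finset.univ (fun i => ∑ j, linearBits (B i j)) (β * R)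
      fun i _ => h1 i
  simp only [sdpBits]
  linarith

variable {n α : ℕ}

/-- The coefficients of the rational semidefinite program are not much larger than the data. -/
lemma ratBits_dualPencil_le {A : Matrix (Fin α) (Fin α) (MvPolynomial (Fin n) ℚ)}
    {l : MvPolynomial (Fin n) ℚ} (hA : IsLinearPencil A) (hl : IsLinearPoly l)
    (i j : DualRow n α) (o : Option (DualVar n α)) :
    ratBits (dualPencil A l i j o) ≤ sdpBits A l + 4 := by
  have h0 : ratBits 0 = 2 := by simp [ratBits]
  have h1 : ratBits 1 = 3 := by simp [ratBits]
  -- Among the integer constants of the pencil, 2 is the longest; it accounts for the summand 4.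
  have h2 : ratBits 2 = 4 := by
    have : Nat.size 2 = 2 := by decide +kernel
    simp [ratBits, this]
  have hA' : ∀ i j μ, ratBits (coeff μ (A i j)) ≤ sdpBits A l + 4 := fun i j μ =>
    (ratBits_coeff_le (hA.2 i j) μ).trans
      ((linearBits_le_sdpBits A l i j).trans (Nat.le_add_right _ _))
  have hl' : ∀ μ, ratBits (coeff μ l) ≤ sdpBits A l + 4 := fun μ =>
    (ratBits_coeff_le hl μ).trans ((Nat.le_add_right _ _).trans (Nat.le_add_right _ _))
  refine dualPencil_induction A l (Q := fun q => ratBits q ≤ sdpBits A l + 4) ?_ ?_ ?_ ?_ hA' ?_ hl'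
    ?_ i j o
  · omega
  · omega
  · rw [ratBits_neg]; omega
  · omega
  · simpa only [ratBits_neg] using hA'
  · simpa only [ratBits_neg] using hl'

lemma exists_isSDPFormulation (A : Matrix (Fin α) (Fin α) (MvPolynomial (Fin n) ℝ))
    (l : MvPolynomial (Fin n) ℝ) (hA : IsLinearPencil A) (hl : IsLinearPoly l) :
    ∃ (m β : ℕ) (B : Matrix (Fin β) (Fin β) (MvPolynomial (Fin m) ℝ))
      (g : MvPolynomial (Fin m) ℝ), IsSDPFormulation A l B g ∧
      m ≤ 5 * (n + α + 1) ^ 5 ∧ β ≤ 14 * (n + α + 1) ^ 5 := by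
  have hπ := image_dualPoint (RingHom.id ℝ) hA hl
  have hmap : A.map (MvPolynomial.map (RingHom.id ℝ)) = A := by
    ext1 i j
    exact MvPolynomial.map_id (A i j)
  rw [hmap, MvPolynomial.map_id] at hπ
  exact ⟨_, _, _, _, isSDPFormulation_of_affEval (RingHom.id ℝ) (isSymm_dualPencil A l)
    (g := varForm ℝ varA) (dualPoint n α) hπ fun y => (affEval_varForm _ y _).symm,
    card_dualVar_le le_rfl, card_dualRow_le le_rfl⟩

lemma exists_rational_isSDPFormulation (A : Matrix (Fin α) (Fin α) (MvPolynomial (Fin n) ℚ))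
    (l : MvPolynomial (Fin n) ℚ) (hA : IsLinearPencil A) (hl : IsLinearPoly l) :
    ∃ (m β : ℕ) (B : Matrix (Fin β) (Fin β) (MvPolynomial (Fin m) ℚ))
      (g : MvPolynomial (Fin m) ℚ),
      IsSDPFormulation (A.map toRealPoly) (toRealPoly l) (B.map toRealPoly) (toRealPoly g) ∧
      sdpBits B g ≤ 10000 * (sdpBits A l + 1) ^ 16 := by
  refine ⟨_, _, _, _, isSDPFormulation_of_affEval (algebraMap ℚ ℝ) (isSymm_dualPencil A l)
    (g := varForm ℚ varA) (dualPoint n α) (image_dualPoint (algebraMap ℚ ℝ) hA hl)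
    fun y => (affEval_varForm _ y _).symm, ?_⟩
  set z := sdpBits A l + 1 with hz
  have hle : n + α + 1 ≤ z := (add_succ_le_sdpBits A l).trans (Nat.le_succ _)
  have hm := card_dualVar_le hle
  have hβ := card_dualRow_le hle
  have hz1 : 1 ≤ z := by omega
  have hz4 : sdpBits A l + 4 ≤ 4 * z := by omega
  refine (sdpBits_le (R := (Fintype.card (DualVar n α) + 1) * (sdpBits A l + 4))
    (fun i j => linearBits_linPoly_le fun o => ratBits_dualPencil_le hA hl _ _ _)
    (linearBits_linPoly_le fun o => ?_)).trans ?_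
  · have h0 : ratBits 0 = 2 := by simp [ratBits]
    have h1 : ratBits 1 = 3 := by simp [ratBits]
    rw [varForm, Pi.single_apply]
    split_ifs <;> omega
  · have h5 : 1 ≤ z ^ 5 := Nat.one_le_pow _ _ hz1
    have h10 : 1 ≤ z ^ 10 := Nat.one_le_pow _ _ hz1
    -- The bound is (number of entries) · (coefficients per entry) · (bits per coefficient), of
    -- degree 10 + 5 + 1, with constant (1 + 14²) · 6 · 4 = 4728.
    calc _ ≤ (z ^ 10 + 14 * z ^ 5 * (14 * z ^ 5)) * ((5 * z ^ 5 + z ^ 5) * (4 * z)) := by gcongr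
      _ = 4728 * z ^ 16 := by ring
      _ ≤ 10000 * z ^ 16 := by gcongr; norm_num

end SosDuality
end

open SosDuality in
theorem mainTheorem4 :
    -- the certificate for nonnegativity on a spectrahedron
    (∀ (n α : ℕ) (A : Matrix (Fin α) (Fin α) (MvPolynomial (Fin n) ℝ))
        (f : MvPolynomial (Fin n) ℝ), IsLinearPencil A → IsLinearPoly f →
      ((∀ x ∈ spectrahedron A, 0 ≤ MvPolynomial.eval x f) ↔
        ∃ (T : Fin n → Matrix (Fin α) (Fin α) (MvPolynomial (Fin n) ℝ))
          (U : Fin n → Matrix (MonomialIndex n 1) (MonomialIndex n 1) ℝ)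
          (W : Fin (n + 1) → Matrix (MonomialIndex n 2) (MonomialIndex n 1) ℝ)
          (S : Matrix (Fin α) (Fin α) ℝ) (c : ℝ),
          (∀ i, IsQuadraticSosMatrix (T i)) ∧ (∀ i, (U i).IsSymm) ∧ W 0 = 0 ∧
          S.PosSemidef ∧ 0 ≤ c ∧
          (∀ i : Fin n,
            polyOfMatrix (U i) + polyOfMatrix (W i.castSucc) + (A * T i).trace = 0) ∧
          (∀ i : Fin n, (U i - (W i.succ).transpose * W i.succ).PosSemidef) ∧
          f - MvPolynomial.C c + polyOfMatrix (W (Fin.last n))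
            - (A * S.map MvPolynomial.C).trace = 0)) ∧
    -- strong duality: zero gap, and attainment in the dual if the common value is finite
    (∀ (n α : ℕ) (A : Matrix (Fin α) (Fin α) (MvPolynomial (Fin n) ℝ))
        (l : MvPolynomial (Fin n) ℝ), IsLinearPencil A → IsLinearPoly l →
      primalValue A l = sosDualValue A l ∧
      ∀ r : ℝ, sosDualValue A l = (r : EReal) → ∃ q ∈ sosDualFeasibleSet A l, q.1 = r) ∧
    -- the dual is a semidefinite program of polynomial size
    (∃ p : Polynomial ℕ,
      (∀ (n α : ℕ) (A : Matrix (Fin α) (Fin α) (MvPolynomial (Fin n) ℝ))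
          (l : MvPolynomial (Fin n) ℝ), IsLinearPencil A → IsLinearPoly l →
        ∃ (m β : ℕ) (B : Matrix (Fin β) (Fin β) (MvPolynomial (Fin m) ℝ))
          (g : MvPolynomial (Fin m) ℝ),
          IsSDPFormulation A l B g ∧ m ≤ p.eval (n + α) ∧ β ≤ p.eval (n + α)) ∧
      (∀ (n α : ℕ) (A : Matrix (Fin α) (Fin α) (MvPolynomial (Fin n) ℚ))
          (l : MvPolynomial (Fin n) ℚ), IsLinearPencil A → IsLinearPoly l →
        ∃ (m β : ℕ) (B : Matrix (Fin β) (Fin β) (MvPolynomial (Fin m) ℚ))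
          (g : MvPolynomial (Fin m) ℚ),
          IsSDPFormulation (A.map toRealPoly) (toRealPoly l) (B.map toRealPoly) (toRealPoly g) ∧
          sdpBits B g ≤ p.eval (sdpBits A l))) := by
  refine ⟨fun n α A f hA hf => nonneg_on_spectrahedron_iff hA hf, fun n α A l hA hl =>
    ⟨primalValue_eq_sosDualValue hA hl, fun r hr => exists_feasible_eq_sosDualValue hA hl hr⟩,
    10000 * (Polynomial.X + 1) ^ 16, fun n α A l hA hl => ?_, fun n α A l hA hl => ?_⟩
  · obtain ⟨m, β, B, g, h, hm, hβ⟩ := exists_isSDPFormulation A l hA hl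
    -- A single polynomial serves both size statements, so the bound on dimensions is absorbed into
    -- the one on bits.
    have hp : 14 * (n + α + 1) ^ 5 ≤ 10000 * (n + α + 1) ^ 16 :=
      Nat.mul_le_mul (by norm_num) (Nat.pow_le_pow_right (Nat.succ_pos _) (by norm_num))
    refine ⟨m, β, B, g, h, ?_, ?_⟩ <;> simp <;> omega
  · obtain ⟨m, β, B, g, h, hb⟩ := exists_rational_isSDPFormulation A l hA hl
    exact ⟨m, β, B, g, h, by simpa using hb⟩
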